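/- Let $x_1,\dots,x_n$ be distinct points in $\mathbb{R}^d$ whose convex hull $P$ has dimension $d$, and write $X=(x_1,\dots,x_n)$. For $y\in\mathbb{R}^n$ and $t\in P$ let $h_{X,y}(t)$ be the largest real $s$ such that $(t,s)\in\mathrm{conv}\{(x_i,y_i)\}$, and let $f_{X,y}=\exp(h_{X,y})$ on $P$ and $f_{X,y}=0$ off $P$. Call $y$ relevant if $h_{X,y}(x_i)=y_i$ for all $i$. A cell of the regular subdivision induced by $y$ is an index set $\sigma=\{i:\ell(x_i)=y_i\}$, where $\ell$ is an affine function with $\ell\ge h_{X,y}$ on $P$ and such that $\{t\in P: h_{X,y}(t)=\ell(t)\}$ has non-empty interior. A regular triangulation $\Delta$ is the set of all cells induced by some $y$, provided that for every cell $\sigma$ the points $x_i$, $i\in\sigma$, are affinely independent. Its secondary cone consists of all $y$ such that for each $\sigma\in\Delta$ there is an affine $\ell$ with $\ell(x_i)=y_i$ for $i\in\sigma$ and $\ell(x_k)\ge y_k$ for all $k$. Let $\mathrm{vol}(\sigma)$ be the normalized volume ($d!$ times Lebesgue measure) of $\mathrm{conv}(x_i:i\in\sigma)$. The GKZ vector of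 $\Delta$ is $z^\Delta_k=\sum_{\sigma\in\Delta,\,k\in\sigma}\mathrm{vol}(\sigma)$, and the secondary polytope $\Sigma(X)$ is the convex hull of the GKZ vectors of all regular triangulations. Let $H:\mathbb{R}^d\to\mathbb{R}$ be the continuous extension of $$H(u)=(-1)^d\,\frac{1+u_1^{-1}+\cdots+u_d^{-1}}{u_1\cdots u_d}+\sum_{j=1}^d\frac{e^{u_j}}{u_j^2\prod_{k\ne j}(u_j-u_k)},$$ and for $y\in\mathbb{R}^n$ let $w^\Delta_k=\sum_{\sigma\in\Delta,\,k\in\sigma}\mathrm{vol}(\sigma)\,e^{y_k}H(\{y_i-y_k: i\in\sigma\setminus k\})$. Let $c=-\log\lambda(P)$, where $\lambda$ is Lebesgue measure, and $y^*=(c,\dots,c)$. Then $\int_{\mathbb{R}^d} f_{X,y^*}(t)\,dt=1$, and for every regular triangulation $\Delta$ the weight vector at $y=y^*$ satisfies $$w^\Delta=\frac{e^c}{(d+1)!}\,z^\Delta .$$ Moreover, for every $w$ in the cone $\{rz: r\ge 0,\ z\in\Sigma(X)\}$: 1. $f_{X,y^*}$ maximizes $\sum_i w_i\log f(x_i)$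 (with $\log 0=-\infty$ and $0\cdot(-\infty)=0$) over all integrable $f:\mathbb{R}^d\to\mathbb{R}_{\ge0}$ such that $\log f$ is concave and $\int f=1$; if $w\ne0$, it is the only maximizer. 2. $y^*$ maximizes $w\cdot y$ over the Samworth body $\{y\in\mathbb{R}^n:\int_P\exp(h_{X,y}(t))\,dt\le1\}$. 3. If $\sum_i w_i=1$, then $y^*$ maximizes $w\cdot y-\int_P\exp(h_{X,y}(t))\,dt$ over $y\in\mathbb{R}^n$. 4. If $\sum_i w_i=1$, then for every regular triangulation $\Delta'$ the pair $(\Delta',y^*)$ maximizes $$w\cdot y-\sum_{\sigma\in\Delta}\mathrm{vol}(\sigma)\sum_{i\in\sigma}\frac{e^{y_i}}{\prod_{j\in\sigma\setminus i}(y_i-y_j)}$$ (the inner sum over $i\in\sigma$ being extended continuously to vectors with repeated coordinates) over all pairs $(\Delta,y)$ of a regular triangulation $\Delta$ and a vector $y$ in its secondary cone. In 2 (for $w\neq 0$), 3 and 4, every maximizing $y$ that is relevant equals $y^*$; if all $w_i>0$, then every maximizing $y$ equals $y^*$. -/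

import Mathlib

open MeasureTheory Set

noncomputable section

namespace LogConcaveMLE

variable {d n : ℕ}

/-- The polytope `P = conv(x_1, …, x_n)`. -/
def polytope (x : Fin n → EuclideanSpace ℝ (Fin d)) : Set (EuclideanSpace ℝ (Fin d)) :=
  convexHull ℝ (range x)

/-- The tent function `h_{X,y}`: `tent x y t` is the largest real `s` such that `(t, s)` lies in
the convex hull of the lifted points `(x_i, y_i)`. Off the polytope the mathematical value is `-∞`;
the real-valued version below is only ever used at points of the polytope. -/
def tent (x : Fin n → EuclideanSpace ℝ (Fin d)) (y : Fin n → ℝ)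
    (t : EuclideanSpace ℝ (Fin d)) : ℝ :=
  sSup {s : ℝ | (t, s) ∈ convexHull ℝ (range fun i => (x i, y i))}

/-- `y` is relevant if every lifted point `(x_i, y_i)` is on the tent. -/
def IsRelevant (x : Fin n → EuclideanSpace ℝ (Fin d)) (y : Fin n → ℝ) : Prop :=
  ∀ i, tent x y (x i) = y i

/-- The function `f_{X,y}`: `exp(h_{X,y})` on the polytope and `0` elsewhere. -/
def tentDensity (x : Fin n → EuclideanSpace ℝ (Fin d)) (y : Fin n → ℝ) :
    EuclideanSpace ℝ (Fin d) → ℝ :=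
  (polytope x).indicator fun t => Real.exp (tent x y t)

/-! ### Regular triangulations, GKZ vectors, secondary polytope -/

/-- `σ` is (the label set of) a cell of the regular subdivision induced by `y`: there is an affine
function `ℓ ≥ h_{X,y}` on `P` whose contact set with the tent is `d`-dimensional (so that this
contact set is a region of linearity), and `σ` consists of the labels of the lifted points which
lie on the corresponding facet of the tent. -/
def IsCell (x : Fin n → EuclideanSpace ℝ (Fin d)) (y : Fin n → ℝ) (σ : Finset (Fin n)) : Prop :=
  ∃ l : EuclideanSpace ℝ (Fin d) →ᵃ[ℝ] ℝ,
    (∀ t ∈ polytope x, tent x y t ≤ l t) ∧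
    (interior {t ∈ polytope x | tent x y t = l t}).Nonempty ∧
    ∀ i, i ∈ σ ↔ l (x i) = y i

/-- `Δ` is a regular triangulation: it is the collection of all cells of the regular subdivision
induced by some `y`, and every cell is a simplex. -/
def IsRegularTriangulation (x : Fin n → EuclideanSpace ℝ (Fin d))
    (Δ : Finset (Finset (Fin n))) : Prop :=
  ∃ y : Fin n → ℝ, (∀ σ, σ ∈ Δ ↔ IsCell x y σ) ∧
    ∀ σ ∈ Δ, AffineIndependent ℝ fun i : σ => x i

/-- Normalized volume of `conv(x_i : i ∈ σ)`, i.e. `d!` times its Lebesgue measure. -/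
def normVol (x : Fin n → EuclideanSpace ℝ (Fin d)) (σ : Finset (Fin n)) : ℝ :=
  (d.factorial : ℝ) * volume.real (convexHull ℝ (x '' (σ : Set (Fin n))))

/-- The GKZ vector `z^Δ`. -/
def gkz (x : Fin n → EuclideanSpace ℝ (Fin d)) (Δ : Finset (Finset (Fin n))) : Fin n → ℝ :=
  fun k => ∑ σ ∈ Δ with k ∈ σ, normVol x σ

/-- The secondary polytope, the convex hull of the GKZ vectors of all regular triangulations. -/
def secondaryPolytope (x : Fin n → EuclideanSpace ℝ (Fin d)) : Set (Fin n → ℝ) :=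
  convexHull ℝ {z | ∃ Δ, IsRegularTriangulation x Δ ∧ z = gkz x Δ}

/-- The cone over the secondary polytope (apex included). -/
def coneOverSecondaryPolytope (x : Fin n → EuclideanSpace ℝ (Fin d)) : Set (Fin n → ℝ) :=
  {w | ∃ r : ℝ, 0 ≤ r ∧ ∃ z ∈ secondaryPolytope x, w = r • z}

/-- The (closed) secondary cone of `Δ`: those `y` for which the piecewise-affine interpolation
of `y` on `Δ` is the tent function, i.e. the lift of each simplex lies on the upper hull. -/
def secondaryCone (x : Fin n → EuclideanSpace ℝ (Fin d)) (Δ : Finset (Finset (Fin n))) :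
    Set (Fin n → ℝ) :=
  {y | ∀ σ ∈ Δ, ∃ l : EuclideanSpace ℝ (Fin d) →ᵃ[ℝ] ℝ,
    (∀ i ∈ σ, l (x i) = y i) ∧ ∀ k, y k ≤ l (x k)}

/-! ### The symmetric function `H` and the weight vectors -/

/-- The explicit formula for `H`, meaningful where the `u_j` are nonzero and distinct. -/
def Hformula {ι : Type*} [Fintype ι] [DecidableEq ι] (u : ι → ℝ) : ℝ :=
  (-1) ^ Fintype.card ι * ((1 + ∑ j, (u j)⁻¹) / ∏ j, u j) +
    ∑ j, Real.exp (u j) / (u j ^ 2 * ∏ k ∈ Finset.univ.erase j, (u j - u k))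

/-- The function `H` on all of `ℝ^d`: the extension of `Hformula` by continuity. -/
def H {ι : Type*} [Fintype ι] [DecidableEq ι] (u : ι → ℝ) : ℝ :=
  extendFrom {v : ι → ℝ | Function.Injective v ∧ ∀ j, v j ≠ 0} Hformula u

/-- The weight vector `w^Δ` attached to the heights `y`. -/
def weightVector (x : Fin n → EuclideanSpace ℝ (Fin d)) (Δ : Finset (Finset (Fin n)))
    (y : Fin n → ℝ) : Fin n → ℝ :=
  fun k => ∑ σ ∈ Δ with k ∈ σ,
    normVol x σ * Real.exp (y k) * H fun i : {i // i ∈ σ.erase k} => y i - y k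

/-! ### The four optimization problems -/

/-- Log-concave probability densities: nonnegative integrable functions with integral `1` whose
logarithm is concave as a function to `[-∞, ∞)`. -/
def logConcaveDensities (d : ℕ) : Set (EuclideanSpace ℝ (Fin d) → ℝ) :=
  {f | (∀ t, 0 ≤ f t) ∧ Integrable f volume ∧
    ConcaveOn ℝ {t | 0 < f t} (fun t => Real.log (f t)) ∧ ∫ t, f t = 1}

/-- The log-likelihood `∑ w_i log f(x_i)`, with `log 0 = -∞` and `0 · (-∞) = 0`. -/
def logLikelihood (x : Fin n → EuclideanSpace ℝ (Fin d)) (w : Fin n → ℝ)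
    (f : EuclideanSpace ℝ (Fin d) → ℝ) : EReal :=
  ∑ i, (w i : EReal) * ENNReal.log (ENNReal.ofReal (f (x i)))

/-- `f` solves the maximum likelihood problem over log-concave densities. -/
def IsOptimalDensity (x : Fin n → EuclideanSpace ℝ (Fin d)) (w : Fin n → ℝ)
    (f : EuclideanSpace ℝ (Fin d) → ℝ) : Prop :=
  f ∈ logConcaveDensities d ∧ IsMaxOn (logLikelihood x w) (logConcaveDensities d) f

/-- The Samworth body. -/
def samworthBody (x : Fin n → EuclideanSpace ℝ (Fin d)) : Set (Fin n → ℝ) :=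
  {y | ∫ t in polytope x, Real.exp (tent x y t) ≤ 1}

/-- `y` maximizes `w · y` over the Samworth body. -/
def IsOptimalConstrained (x : Fin n → EuclideanSpace ℝ (Fin d)) (w y : Fin n → ℝ) : Prop :=
  y ∈ samworthBody x ∧ IsMaxOn (fun v => ∑ i, w i * v i) (samworthBody x) y

/-- `y` maximizes `w · y - ∫_P exp(h_{X,y})` over `ℝ^n`. -/
def IsOptimalUnconstrained (x : Fin n → EuclideanSpace ℝ (Fin d)) (w y : Fin n → ℝ) : Prop :=
  IsMaxOn (fun v => ∑ i, w i * v i - ∫ t in polytope x, Real.exp (tent x v t)) univ y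

/-- The expression `∑_i exp(y_i) / ∏_{j ≠ i} (y_i - y_j)`, meaningful for distinct `y_i`. -/
def expSumFormula {ι : Type*} [Fintype ι] [DecidableEq ι] (y : ι → ℝ) : ℝ :=
  ∑ i, Real.exp (y i) / ∏ j ∈ Finset.univ.erase i, (y i - y j)

/-- The extension of `expSumFormula` by continuity to all vectors. -/
def expSum {ι : Type*} [Fintype ι] [DecidableEq ι] (y : ι → ℝ) : ℝ :=
  extendFrom {v : ι → ℝ | Function.Injective v} expSumFormula y

/-- The exponential-rational form of the objective function on the secondary cone of `Δ`. -/
def secondaryObjective (x : Fin n → EuclideanSpace ℝ (Fin d)) (w : Fin n → ℝ)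
    (Δ : Finset (Finset (Fin n))) (y : Fin n → ℝ) : ℝ :=
  ∑ i, w i * y i - ∑ σ ∈ Δ, normVol x σ * expSum fun i : {i // i ∈ σ} => y i

/-- `(Δ, y)` maximizes the exponential-rational objective among all pairs of a regular
triangulation and a vector in its secondary cone. -/
def IsOptimalSecondary (x : Fin n → EuclideanSpace ℝ (Fin d)) (w : Fin n → ℝ)
    (Δ : Finset (Finset (Fin n))) (y : Fin n → ℝ) : Prop :=
  (IsRegularTriangulation x Δ ∧ y ∈ secondaryCone x Δ) ∧
    IsMaxOn (fun p : Finset (Finset (Fin n)) × (Fin n → ℝ) => secondaryObjective x w p.1 p.2)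
      {p | IsRegularTriangulation x p.1 ∧ p.2 ∈ secondaryCone x p.1} (Δ, y)

end LogConcaveMLE

end

noncomputable section

namespace LogConcaveMLE

variable {d n : ℕ}

/-! ### The tent function -/

/-! Everything about optimality follows from one inequality. An affine function on a simplex has
mean equal to the mean of its vertex values, so `z^Δ · y` is `(d+1)!` times the integral over `P` of
the piecewise affine interpolant of `y` on `Δ`. The tent is concave and lies above the data, hence
above that interpolant, so `z · y ≤ (d+1)! ∫ h` for GKZ vectors, and by linearity on the whole
secondary polytope. Since `z` has coordinate sum `(d+1)! vol P`, every `w` in the cone satisfies `w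
· y ≤ (∑ w) · mean(h)` (`cone_sum_mul_le`). The tangent line of `exp` at `c`, integrated using `e^c
vol P = 1`, gives `mean(h) ≤ c - 1 + ∫ e^h` (`mean_tent_le`). The combined bound is attained at the
constant vector `c`, which settles the three problems over `y`.

In the equality case (`eq_const_of_sum_mul_eq`) strict convexity of `exp` forces `h = c` almost
everywhere, so `h ≤ c` on `P`, and `y_k = c` wherever `w_k > 0`. The cells of a triangulation cover
`P`, so for `w ≠ 0` the points of positive weight have convex hull `P`; hence `h = c` on `P`, and a
relevant `y` is constant.

A log-concave density is compared with the vector of its log values at the `x_i`: their tent lies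
below `log f`, so this vector lies in the Samworth body.

The two continuous extensions are divided differences of `exp`. Written as integrals over a simplex
(Hermite–Genocchi, `simplexExpIntegral_eq`) they are continuous also at repeated nodes. `H` has
nodes `0, 0, u_1, …, u_d`, so its value at `u = 0` is the volume `1/(d+1)!` of the corner simplex in
dimension `d+1`. -/

theorem mem_convexHull_range_iff {ι E : Type*} [Fintype ι] [AddCommGroup E] [Module ℝ E]
    {v : ι → E} {t : E} :
    t ∈ convexHull ℝ (range v) ↔
      ∃ a : ι → ℝ, (∀ i, 0 ≤ a i) ∧ ∑ i, a i = 1 ∧ ∑ i, a i • v i = t := by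
  classical
  constructor
  · intro h
    have : convexHull ℝ (range v) ⊆
        {t | ∃ a : ι → ℝ, (∀ i, 0 ≤ a i) ∧ ∑ i, a i = 1 ∧ ∑ i, a i • v i = t} := by
      apply convexHull_min
      · rintro _ ⟨i, rfl⟩
        refine ⟨Pi.single i 1, fun j => ?_, ?_, ?_⟩
        · by_cases h : j = i
          · subst h; simp
          · simp [h]
        · simp
        · simp [Pi.single_apply, ite_smul]
      · rintro p ⟨a, ha, ha1, rfl⟩ q ⟨b, hb, hb1, rfl⟩ r s hr hs hrs
        refine ⟨fun i => r * a i + s * b i, fun i => ?_, ?_, ?_⟩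
        · have := ha i; have := hb i; positivity
        · rw [Finset.sum_add_distrib, ← Finset.mul_sum, ← Finset.mul_sum, ha1, hb1]; linarith
        · simp [add_smul, Finset.sum_add_distrib, Finset.smul_sum, mul_smul]
    exact this h
  · rintro ⟨a, ha, ha1, rfl⟩
    exact (convex_convexHull ℝ _).sum_mem (fun i _ => ha i) ha1
      fun i _ => subset_convexHull ℝ _ (mem_range_self i)

theorem polytope_isCompact (x : Fin n → EuclideanSpace ℝ (Fin d)) : IsCompact (polytope x) :=
  (finite_range x).isCompact_convexHull (𝕜 := ℝ)

theorem polytope_convex (x : Fin n → EuclideanSpace ℝ (Fin d)) : Convex ℝ (polytope x) :=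
  convex_convexHull ℝ _

theorem vertex_mem_polytope (x : Fin n → EuclideanSpace ℝ (Fin d)) (i : Fin n) :
    x i ∈ polytope x :=
  subset_convexHull ℝ _ (mem_range_self i)

/-- The vertical fibre over `t` is a closed slice of a compact polytope, so the supremum is
attained. -/
theorem tent_isGreatest (x : Fin n → EuclideanSpace ℝ (Fin d)) (y : Fin n → ℝ)
    {t : EuclideanSpace ℝ (Fin d)} (ht : t ∈ polytope x) :
    IsGreatest {s : ℝ | (t, s) ∈ convexHull ℝ (range fun i => (x i, y i))} (tent x y t) := by
  have hK : IsCompact (convexHull ℝ (range fun i => (x i, y i))) :=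
    (finite_range _).isCompact_convexHull (𝕜 := ℝ)
  have hc : IsCompact {s : ℝ | (t, s) ∈ convexHull ℝ (range fun i => (x i, y i))} := by
    have : {s : ℝ | (t, s) ∈ convexHull ℝ (range fun i => (x i, y i))} =
        Prod.snd '' (convexHull ℝ (range fun i => (x i, y i)) ∩ Prod.fst ⁻¹' {t}) := by
      ext s
      constructor
      · intro h
        exact ⟨(t, s), ⟨h, rfl⟩, rfl⟩
      · rintro ⟨⟨t', s'⟩, ⟨h, h'⟩, rfl⟩
        obtain rfl : t' = t := h'
        exact h
    rw [this]
    exact (hK.inter_right (isClosed_singleton.preimage continuous_fst)).image continuous_snd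
  apply hc.isGreatest_sSup
  obtain ⟨a, ha, ha1, hat⟩ := mem_convexHull_range_iff.1 ht
  refine ⟨∑ i, a i * y i, mem_convexHull_range_iff.2 ⟨a, ha, ha1, ?_⟩⟩
  ext1
  · simp [Prod.fst_sum, hat]
  · simp [Prod.snd_sum]

theorem exists_weights_eq_tent (x : Fin n → EuclideanSpace ℝ (Fin d)) (y : Fin n → ℝ)
    {t : EuclideanSpace ℝ (Fin d)} (ht : t ∈ polytope x) :
    ∃ a : Fin n → ℝ, (∀ i, 0 ≤ a i) ∧ ∑ i, a i = 1 ∧ ∑ i, a i • x i = t ∧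
      ∑ i, a i * y i = tent x y t := by
  obtain ⟨a, ha, ha1, h⟩ := mem_convexHull_range_iff.1 (tent_isGreatest x y ht).1
  refine ⟨a, ha, ha1, ?_, ?_⟩
  · simpa [Prod.fst_sum] using congrArg Prod.fst h
  · simpa [Prod.snd_sum] using congrArg Prod.snd h

/-- Jensen's inequality for weights that attain the tent. Together with `tent_concaveOn` and
`le_tent_vertex`, this characterizes the tent as the least concave majorant of the data. -/
theorem tent_le_of_concaveOn (x : Fin n → EuclideanSpace ℝ (Fin d)) (y : Fin n → ℝ)
    {g : EuclideanSpace ℝ (Fin d) → ℝ} (hg : ConcaveOn ℝ (polytope x) g)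
    (hy : ∀ i, y i ≤ g (x i)) {t : EuclideanSpace ℝ (Fin d)} (ht : t ∈ polytope x) :
    tent x y t ≤ g t := by
  obtain ⟨a, ha, ha1, rfl, h⟩ := exists_weights_eq_tent x y ht
  rw [← h]
  refine le_trans (Finset.sum_le_sum fun i _ => mul_le_mul_of_nonneg_left (hy i) (ha i)) ?_
  simpa using hg.le_map_sum (t := Finset.univ) (fun i _ => ha i) ha1
    fun i _ => vertex_mem_polytope x i

theorem tent_concaveOn (x : Fin n → EuclideanSpace ℝ (Fin d)) (y : Fin n → ℝ) :
    ConcaveOn ℝ (polytope x) (tent x y) := by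
  refine ⟨polytope_convex x, fun p hp q hq r s hr hs hrs => ?_⟩
  have hm : r • p + s • q ∈ polytope x := polytope_convex x hp hq hr hs hrs
  apply (tent_isGreatest x y hm).2
  exact convex_convexHull ℝ (range fun i => (x i, y i)) (tent_isGreatest x y hp).1
    (tent_isGreatest x y hq).1 hr hs hrs

theorem le_tent_vertex (x : Fin n → EuclideanSpace ℝ (Fin d)) (y : Fin n → ℝ) (i : Fin n) :
    y i ≤ tent x y (x i) :=
  (tent_isGreatest x y (vertex_mem_polytope x i)).2
    (subset_convexHull ℝ _ (mem_range_self i))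

theorem affine_concaveOn {E : Type*} [AddCommGroup E] [Module ℝ E] (l : E →ᵃ[ℝ] ℝ)
    {s : Set E} (hs : Convex ℝ s) : ConcaveOn ℝ s l :=
  ⟨hs, fun _ _ _ _ _ _ _ _ hab => (Convex.combo_affine_apply hab).ge⟩

theorem affine_map_sum {ι E : Type*} [Fintype ι] [AddCommGroup E] [Module ℝ E] (l : E →ᵃ[ℝ] ℝ)
    {a : ι → ℝ} (ha1 : ∑ i, a i = 1) (v : ι → E) :
    l (∑ i, a i • v i) = ∑ i, a i * l (v i) := by
  have h : ∀ t, l t = l.linear t + l 0 := fun t => by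
    simpa using congrFun (AffineMap.decomp l) t
  rw [h]
  simp_rw [h (v _), mul_add, Finset.sum_add_distrib, ← Finset.sum_mul, ha1, map_sum, map_smul]
  simp

theorem tent_le_affine (x : Fin n → EuclideanSpace ℝ (Fin d)) (y : Fin n → ℝ)
    {l : EuclideanSpace ℝ (Fin d) →ᵃ[ℝ] ℝ} (hl : ∀ i, y i ≤ l (x i))
    {t : EuclideanSpace ℝ (Fin d)} (ht : t ∈ polytope x) : tent x y t ≤ l t :=
  tent_le_of_concaveOn x y (affine_concaveOn l (polytope_convex x)) hl ht

theorem polytope_interior_nonempty {x : Fin n → EuclideanSpace ℝ (Fin d)}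
    (hfull : affineSpan ℝ (range x) = ⊤) : (interior (polytope x)).Nonempty :=
  interior_convexHull_nonempty_iff_affineSpan_eq_top.2 hfull

theorem volume_polytope_pos {x : Fin n → EuclideanSpace ℝ (Fin d)}
    (hfull : affineSpan ℝ (range x) = ⊤) : 0 < volume.real (polytope x) :=
  ENNReal.toReal_pos
    (Measure.measure_pos_of_nonempty_interior _ (polytope_interior_nonempty hfull)).ne'
    (polytope_isCompact x).measure_lt_top.ne

theorem tent_const (x : Fin n → EuclideanSpace ℝ (Fin d)) (c : ℝ)
    {t : EuclideanSpace ℝ (Fin d)} (ht : t ∈ polytope x) : tent x (fun _ => c) t = c := by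
  obtain ⟨a, ha, ha1, rfl, h⟩ := exists_weights_eq_tent x (fun _ => c) ht
  rw [← h, ← Finset.sum_mul, ha1, one_mul]

theorem abs_tent_le (x : Fin n → EuclideanSpace ℝ (Fin d)) (y : Fin n → ℝ)
    {t : EuclideanSpace ℝ (Fin d)} (ht : t ∈ polytope x) : |tent x y t| ≤ ∑ i, |y i| := by
  obtain ⟨a, ha, ha1, -, h⟩ := exists_weights_eq_tent x y ht
  rw [← h]
  refine (Finset.abs_sum_le_sum_abs _ _).trans (Finset.sum_le_sum fun i hi => ?_)
  rw [abs_mul, abs_of_nonneg (ha i)]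
  exact mul_le_of_le_one_left (abs_nonneg _)
    (ha1 ▸ Finset.single_le_sum (fun j _ => ha j) hi)

/-- Convex sets have null frontier. This reduces measurability of the tent to the interior, where
concave functions are continuous. -/
theorem restrict_interior_polytope {x : Fin n → EuclideanSpace ℝ (Fin d)} :
    volume.restrict (interior (polytope x)) = volume.restrict (polytope x) := by
  apply Measure.restrict_congr_set
  exact interior_ae_eq_of_null_frontier ((polytope_convex x).addHaar_frontier volume)

theorem tent_aestronglyMeasurable (x : Fin n → EuclideanSpace ℝ (Fin d)) (y : Fin n → ℝ) :
    AEStronglyMeasurable (tent x y) (volume.restrict (polytope x)) := by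
  rw [← restrict_interior_polytope]
  exact (tent_concaveOn x y).continuousOn_interior.aestronglyMeasurable
    isOpen_interior.measurableSet

theorem comp_tent_integrableOn (x : Fin n → EuclideanSpace ℝ (Fin d)) (y : Fin n → ℝ)
    {φ : ℝ → ℝ} (hφ : Continuous φ) :
    IntegrableOn (fun t => φ (tent x y t)) (polytope x) volume := by
  obtain ⟨C, hC⟩ := (isCompact_Icc (a := -∑ i, |y i|) (b := ∑ i, |y i|)).exists_bound_of_continuousOn
    hφ.continuousOn
  refine IntegrableOn.of_bound (polytope_isCompact x).measure_lt_top
    (hφ.comp_aestronglyMeasurable (tent_aestronglyMeasurable x y)) C ?_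
  refine (ae_restrict_iff' (polytope_isCompact x).measurableSet).2 (.of_forall fun t ht => ?_)
  exact hC _ (abs_le.1 (abs_tent_le x y ht))

/-! ### The geometry of regular triangulations -/

/-- Hahn–Banach separates `(t, g t)` from the strict hypograph over the interior, which is open
because `g` is continuous there. -/
theorem exists_supporting_affine {E : Type*} [NormedAddCommGroup E] [NormedSpace ℝ E]
    [FiniteDimensional ℝ E] {s : Set E} {g : E → ℝ} (hg : ConcaveOn ℝ s g) {t : E}
    (ht : t ∈ interior s) : ∃ l : E →ᵃ[ℝ] ℝ, (∀ p ∈ s, g p ≤ l p) ∧ g t = l t := by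
  have hg' : ConcaveOn ℝ (interior s) g := hg.subset interior_subset hg.1.interior
  have hopen : IsOpen {p : E × ℝ | p.1 ∈ interior s ∧ p.2 < g p.1} := by
    have hc : ContinuousOn (fun p : E × ℝ => g p.1 - p.2) (Prod.fst ⁻¹' interior s) :=
      (hg.continuousOn_interior.comp continuousOn_fst fun _ h => h).sub continuousOn_snd
    convert! hc.isOpen_inter_preimage (isOpen_interior.preimage continuous_fst)
      (isOpen_Ioi (a := (0 : ℝ))) using 1
    ext p
    simp
  obtain ⟨f, hf⟩ := geometric_hahn_banach_open_point hg'.convex_strict_hypograph hopen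
    (x := (t, g t)) (fun h => lt_irrefl _ h.2)
  have hfs : ∀ p r, f (p, r) = f (p, 0) + r * f (0, 1) := fun p r => by
    rw [← smul_eq_mul, ← map_smul, ← map_add]; simp
  -- The separating hyperplane is not vertical: the point directly below `(t, g t)` lies in the
  -- hypograph.
  have hb : 0 < f (0, 1) := by
    have := hf (t, g t - 1) ⟨ht, by simp⟩
    rw [hfs t (g t - 1), hfs t (g t)] at this
    linarith
  have hint : ∀ p ∈ interior s, f (p, 0) + g p * f (0, 1) ≤ f (t, 0) + g t * f (0, 1) := by
    intro p hp
    refine le_of_forall_pos_le_add fun ε hε => ?_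
    have := hf (p, g p - ε / f (0, 1)) ⟨hp, by simp; positivity⟩
    rw [hfs p, hfs t (g t), sub_mul, div_mul_cancel₀ _ hb.ne'] at this
    linarith
  let L : E →ₗ[ℝ] ℝ := (f (0, 1))⁻¹ • (f : E × ℝ →ₗ[ℝ] ℝ) ∘ₗ LinearMap.inl ℝ E ℝ
  have hL : ∀ p, L p * f (0, 1) = f (p, 0) := fun p => by
    simp only [L, LinearMap.smul_apply, LinearMap.comp_apply, LinearMap.inl_apply, smul_eq_mul]
    rw [mul_comm, mul_inv_cancel_left₀ hb.ne']
    rfl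
  let l : E →ᵃ[ℝ] ℝ := AffineMap.const ℝ E (g t + L t) - L.toAffineMap
  have hl : ∀ p, l p = g t + L t - L p := fun p => rfl
  have hli : ∀ p ∈ interior s, g p ≤ l p := fun p hp => by
    have := hint p hp
    rw [← hL, ← hL, ← add_mul, ← add_mul] at this
    have := le_of_mul_le_mul_right this hb
    rw [hl]; linarith
  refine ⟨l, fun p hp => ?_, by rw [hl]; ring⟩
  have hm := hli _ (hg.1.combo_interior_self_mem_interior ht hp (a := 1 / 2) (b := 1 / 2)
    (by norm_num) (by norm_num) (by norm_num))
  have h2 := hg.2 (interior_subset ht) hp (by norm_num : (0 : ℝ) ≤ 1 / 2)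
    (by norm_num : (0 : ℝ) ≤ 1 / 2) (by norm_num)
  rw [hl, map_add, map_smul, map_smul] at hm
  simp only [smul_eq_mul] at h2 hm
  rw [hl]; linarith

/-- The geometric realization `conv(x_i : i ∈ σ)` of a label set. -/
abbrev cellHull (x : Fin n → EuclideanSpace ℝ (Fin d)) (σ : Finset (Fin n)) :
    Set (EuclideanSpace ℝ (Fin d)) :=
  convexHull ℝ (x '' (σ : Set (Fin n)))

theorem cellHull_isCompact (x : Fin n → EuclideanSpace ℝ (Fin d)) (σ : Finset (Fin n)) :
    IsCompact (cellHull x σ) :=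
  ((σ.finite_toSet).image x).isCompact_convexHull (𝕜 := ℝ)

theorem cellHull_subset_polytope (x : Fin n → EuclideanSpace ℝ (Fin d)) (σ : Finset (Fin n)) :
    cellHull x σ ⊆ polytope x :=
  convexHull_mono (image_subset_range _ _)

/-- Weights attaining the tent at a contact point cannot charge an index with `y i < l (x i)`, since
that would make the average of `y` strictly smaller than `l`. -/
theorem contact_eq_cellHull (x : Fin n → EuclideanSpace ℝ (Fin d)) (y : Fin n → ℝ)
    {l : EuclideanSpace ℝ (Fin d) →ᵃ[ℝ] ℝ} (hl : ∀ i, y i ≤ l (x i)) {σ : Finset (Fin n)}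
    (hσ : ∀ i, i ∈ σ ↔ l (x i) = y i) :
    {t ∈ polytope x | tent x y t = l t} = cellHull x σ := by
  apply Subset.antisymm
  · rintro t ⟨ht, htl⟩
    obtain ⟨a, ha, ha1, rfl, h⟩ := exists_weights_eq_tent x y ht
    rw [← h, affine_map_sum l ha1] at htl
    have h0 : ∀ i ∉ σ, a i = 0 := by
      intro i hi
      by_contra hne
      refine htl.not_lt (Finset.sum_lt_sum
        (fun j _ => mul_le_mul_of_nonneg_left (hl j) (ha j)) ⟨i, Finset.mem_univ i, ?_⟩)
      exact mul_lt_mul_of_pos_left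
        (lt_of_le_of_ne (hl i) fun h => hi ((hσ i).2 h.symm)) ((ha i).lt_of_ne' hne)
    rw [← Finset.sum_subset (Finset.subset_univ σ) fun i _ hi => by rw [h0 i hi, zero_smul]]
    refine (convex_convexHull ℝ _).sum_mem (fun i _ => ha i) ?_
      fun i hi => subset_convexHull ℝ _ (mem_image_of_mem x hi)
    rw [← ha1]
    exact Finset.sum_subset (Finset.subset_univ σ) fun i _ hi => h0 i hi
  · apply convexHull_min
    · rintro _ ⟨i, hi, rfl⟩
      refine ⟨vertex_mem_polytope x i, le_antisymm
        (tent_le_affine x y hl (vertex_mem_polytope x i)) ?_⟩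
      rw [(hσ i).1 hi]
      exact le_tent_vertex x y i
    · rintro p ⟨hp, hpl⟩ q ⟨hq, hql⟩ r s hr hs hrs
      have hm := polytope_convex x hp hq hr hs hrs
      refine ⟨hm, le_antisymm (tent_le_affine x y hl hm) ?_⟩
      rw [Convex.combo_affine_apply hrs, ← hpl, ← hql]
      exact (tent_concaveOn x y).2 hp hq hr hs hrs

theorem IsCell.exists_affine {x : Fin n → EuclideanSpace ℝ (Fin d)} {y : Fin n → ℝ}
    {σ : Finset (Fin n)} (h : IsCell x y σ) :
    ∃ l : EuclideanSpace ℝ (Fin d) →ᵃ[ℝ] ℝ, (∀ i, i ∈ σ ↔ l (x i) = y i) ∧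
      {t ∈ polytope x | tent x y t = l t} = cellHull x σ ∧ (interior (cellHull x σ)).Nonempty := by
  obtain ⟨l, hl, hi, hσ⟩ := h
  have := contact_eq_cellHull x y (l := l)
    (fun i => (le_tent_vertex x y i).trans (hl _ (vertex_mem_polytope x i))) hσ
  exact ⟨l, hσ, this, this ▸ hi⟩

theorem volume_eq_zero_of_interior_empty (x : Fin n → EuclideanSpace ℝ (Fin d))
    {σ : Finset (Fin n)} (h : ¬ (interior (cellHull x σ)).Nonempty) :
    volume (cellHull x σ) = 0 := by
  refine measure_mono_null ?_ ((convex_convexHull ℝ (x '' (σ : Set (Fin n)))).addHaar_frontier volume)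
  intro t ht
  exact ⟨subset_closure ht, fun hti => h ⟨t, hti⟩⟩

namespace IsRegularTriangulation

variable {x : Fin n → EuclideanSpace ℝ (Fin d)} {Δ : Finset (Finset (Fin n))}

theorem interior_nonempty (h : IsRegularTriangulation x Δ) {σ : Finset (Fin n)} (hσ : σ ∈ Δ) :
    (interior (cellHull x σ)).Nonempty := by
  obtain ⟨y, hy, -⟩ := h
  obtain ⟨-, -, -, hi⟩ := ((hy σ).1 hσ).exists_affine
  exact hi

theorem affineIndependent (h : IsRegularTriangulation x Δ) {σ : Finset (Fin n)} (hσ : σ ∈ Δ) :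
    AffineIndependent ℝ fun i : σ => x i := by
  obtain ⟨y, -, hy⟩ := h
  exact hy σ hσ

theorem card_cell (h : IsRegularTriangulation x Δ) {σ : Finset (Fin n)} (hσ : σ ∈ Δ) :
    σ.card = d + 1 := by
  have h1 := h.affineIndependent hσ
  have h2 := interior_convexHull_nonempty_iff_affineSpan_eq_top.1 (h.interior_nonempty hσ)
  have h3 : range (fun i : σ => x i) = x '' (σ : Set (Fin n)) := by
    ext t; simp
  rw [← h3, h1.affineSpan_eq_top_iff_card_eq_finrank_add_one] at h2
  simpa using h2

theorem normVol_pos (h : IsRegularTriangulation x Δ) {σ : Finset (Fin n)} (hσ : σ ∈ Δ) :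
    0 < normVol x σ :=
  mul_pos (by positivity) (ENNReal.toReal_pos
    (Measure.measure_pos_of_nonempty_interior _ (h.interior_nonempty hσ)).ne'
    (cellHull_isCompact x σ).measure_lt_top.ne)

/-- Distinct cells have distinct affine functions, and both agree with the tent on the overlap,
which therefore lies in a proper affine subspace. -/
theorem aedisjoint (h : IsRegularTriangulation x Δ) :
    Pairwise (Function.onFun (AEDisjoint volume) fun σ : Δ => cellHull x (σ : Finset (Fin n))) := by
  obtain ⟨y, hy, -⟩ := h
  rintro ⟨σ, hσ⟩ ⟨τ, hτ⟩ hne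
  obtain ⟨l, hl, hlc, -⟩ := ((hy σ).1 hσ).exists_affine
  obtain ⟨m, hm, hmc, -⟩ := ((hy τ).1 hτ).exists_affine
  have hlm : l ≠ m := by
    rintro rfl
    refine hne (Subtype.ext (Finset.ext fun i => ?_))
    rw [hl, hm]
  let S : AffineSubspace ℝ (EuclideanSpace ℝ (Fin d)) :=
    (AffineSubspace.mk' (0 : ℝ) ⊥).comap (l - m)
  have hS : ∀ t, t ∈ S ↔ l t = m t := fun t => by
    simp [S, AffineSubspace.mem_comap, AffineSubspace.mem_mk', sub_eq_zero]
  have hS0 : volume (S : Set (EuclideanSpace ℝ (Fin d))) = 0 := by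
    refine Measure.addHaar_affineSubspace volume S fun htop => hlm ?_
    ext t
    exact (hS t).1 (htop ▸ AffineSubspace.mem_top _ _ _)
  refine measure_mono_null (fun t ht => ?_) hS0
  simp only [← hlc, ← hmc] at ht
  exact (hS t).2 (ht.1.2.symm.trans ht.2.2)

/-- The supporting affine function at an interior point has as contact set the hull of some label
set. Unless that hull has empty interior, it is a cell; the finitely many hulls with empty interior
are null. -/
theorem iUnion_ae_eq (h : IsRegularTriangulation x Δ) :
    (⋃ σ : Δ, cellHull x (σ : Finset (Fin n)) : Set _) =ᵐ[volume] polytope x := by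
  classical
  obtain ⟨y, hy, -⟩ := h
  have hN : volume (⋃ τ ∈ {τ : Finset (Fin n) | ¬ (interior (cellHull x τ)).Nonempty},
      cellHull x τ) = 0 :=
    (measure_biUnion_null_iff (Set.to_countable _)).2 fun τ hτ =>
      volume_eq_zero_of_interior_empty x hτ
  have hF := (polytope_convex x).addHaar_frontier volume
  refine Filter.EventuallyLE.antisymm ?_ ?_
  · exact Filter.Eventually.of_forall fun t ht => by
      obtain ⟨σ, hσ⟩ := mem_iUnion.1 ht
      exact cellHull_subset_polytope x _ hσ
  · filter_upwards [measure_eq_zero_iff_ae_notMem.1 hN, measure_eq_zero_iff_ae_notMem.1 hF]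
      with t htN htF htP
    change t ∈ polytope x at htP
    have hti : t ∈ interior (polytope x) := by
      by_contra hti
      exact htF ⟨subset_closure htP, hti⟩
    obtain ⟨l, hl, hlt⟩ := exists_supporting_affine (tent_concaveOn x y) hti
    let σ : Finset (Fin n) := Finset.univ.filter fun i => l (x i) = y i
    have hσ : ∀ i, i ∈ σ ↔ l (x i) = y i := fun i => by simp [σ]
    have hc := contact_eq_cellHull x y (l := l)
      (fun i => (le_tent_vertex x y i).trans (hl _ (vertex_mem_polytope x i))) hσ
    have htσ : t ∈ cellHull x σ := hc ▸ ⟨htP, hlt⟩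
    have hint : (interior (cellHull x σ)).Nonempty := by
      by_contra hne
      exact htN (mem_biUnion hne htσ)
    exact mem_iUnion.2 ⟨⟨σ, (hy σ).2 ⟨l, hl, hc ▸ hint, hσ⟩⟩, htσ⟩

theorem setIntegral_polytope (h : IsRegularTriangulation x Δ)
    {g : EuclideanSpace ℝ (Fin d) → ℝ} (hg : IntegrableOn g (polytope x)) :
    ∫ t in polytope x, g t = ∑ σ ∈ Δ, ∫ t in cellHull x σ, g t := by
  have hg' : IntegrableOn g (⋃ σ : Δ, cellHull x (σ : Finset (Fin n))) :=
    hg.mono_set (iUnion_subset fun σ => cellHull_subset_polytope x _)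
  rw [← setIntegral_congr_set h.iUnion_ae_eq, integral_iUnion_ae
    (fun σ => (cellHull_isCompact x _).measurableSet.nullMeasurableSet) h.aedisjoint hg',
    tsum_fintype, Finset.sum_coe_sort Δ fun σ => ∫ t in cellHull x σ, g t]

/-- The uncovered part of the interior is open and null, hence empty; closedness of the finite union
does the rest. Exact covering is what `polytope_subset_hull_gkz_pos` needs. -/
theorem polytope_eq_iUnion (hfull : affineSpan ℝ (range x) = ⊤) (h : IsRegularTriangulation x Δ) :
    polytope x = ⋃ σ : Δ, cellHull x (σ : Finset (Fin n)) := by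
  have hcl : IsClosed (⋃ σ : Δ, cellHull x (σ : Finset (Fin n))) :=
    isClosed_iUnion_of_finite fun σ => (cellHull_isCompact x _).isClosed
  apply Subset.antisymm _ (iUnion_subset fun σ => cellHull_subset_polytope x _)
  have hint : interior (polytope x) ⊆ ⋃ σ : Δ, cellHull x (σ : Finset (Fin n)) := by
    have hz : volume (interior (polytope x) \ ⋃ σ : Δ, cellHull x (σ : Finset (Fin n))) = 0 :=
      measure_mono_null (sdiff_subset_sdiff_left interior_subset)
        (ae_le_set.1 h.iUnion_ae_eq.symm.le)
    rw [(isOpen_interior.sdiff hcl).measure_eq_zero_iff volume] at hz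
    exact sdiff_eq_empty.1 hz
  calc polytope x ⊆ closure (interior (polytope x)) := by
        rw [(polytope_convex x).closure_interior_eq_closure_of_nonempty_interior
          (polytope_interior_nonempty hfull)]
        exact subset_closure
    _ ⊆ _ := closure_minimal hint hcl

end IsRegularTriangulation

/-! ### Integrals over the corner simplex -/

/-- The corner simplex `{t ≥ 0 : ∑ t_i ≤ s}` in `ℝ^m`. -/
def cornerSimplex (m : ℕ) (s : ℝ) : Set (Fin m → ℝ) :=
  {t | (∀ i, 0 ≤ t i) ∧ ∑ i, t i ≤ s}

/-- The affine interpolation `∑ i < m, t_i y_i + (s - ∑ t_i) y_m` on `cornerSimplex m s`. -/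
def simplexForm (m : ℕ) (s : ℝ) (y : Fin (m + 1) → ℝ) (t : Fin m → ℝ) : ℝ :=
  ∑ i, t i * y i.castSucc + (s - ∑ i, t i) * y (Fin.last m)

/-- The integral `∫ exp (simplexForm m s y)` over the corner simplex. -/
def simplexExpIntegral (m : ℕ) (s : ℝ) (y : Fin (m + 1) → ℝ) : ℝ :=
  ∫ t in cornerSimplex m s, Real.exp (simplexForm m s y t)

theorem cornerSimplex_isCompact (m : ℕ) (s : ℝ) : IsCompact (cornerSimplex m s) := by
  refine (isCompact_Icc (a := (0 : Fin m → ℝ)) (b := fun _ => s)).of_isClosed_subset ?_ ?_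
  · have h1 : IsClosed {t : Fin m → ℝ | ∀ i, 0 ≤ t i} := by
      simp only [ofPred_forall]
      exact isClosed_iInter fun i => isClosed_le continuous_const (continuous_apply i)
    exact h1.inter (isClosed_le (f := fun t : Fin m → ℝ => ∑ i, t i) (by fun_prop) continuous_const)
  · rintro t ⟨h0, h1⟩
    exact ⟨h0, fun i => (Finset.single_le_sum (fun j _ => h0 j) (Finset.mem_univ i)).trans h1⟩

theorem cons_mem_cornerSimplex {m : ℕ} {s r : ℝ} {t : Fin m → ℝ} :
    (Fin.cons r t : Fin (m + 1) → ℝ) ∈ cornerSimplex (m + 1) s ↔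
      0 ≤ r ∧ t ∈ cornerSimplex m (s - r) := by
  simp only [cornerSimplex, mem_ofPred_eq, Fin.forall_fin_succ, Fin.cons_zero, Fin.cons_succ,
    Fin.sum_univ_succ, and_assoc, le_sub_iff_add_le']

theorem cornerSimplex_eq_empty {m : ℕ} {s : ℝ} (hs : s < 0) : cornerSimplex m s = ∅ := by
  refine eq_empty_of_forall_notMem fun t ht => ?_
  have := Finset.sum_nonneg fun i (_ : i ∈ Finset.univ) => ht.1 i
  linarith [ht.2]

theorem setIntegral_cornerSimplex_zero {s : ℝ} (hs : 0 ≤ s) (f : (Fin 0 → ℝ) → ℝ) :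
    ∫ t in cornerSimplex 0 s, f t = f 0 := by
  have h : cornerSimplex 0 s = univ := by
    ext t; simp [cornerSimplex, hs]
  rw [h, setIntegral_univ, integral_unique]
  rw [congrArg f (Subsingleton.elim _ 0)]
  simp [measureReal_def, volume_pi]

/-- Fubini in the first coordinate. The slice at `r` is a corner simplex of size `s - r`, which is
why the size is kept as a parameter in the inductions below. -/
theorem setIntegral_cornerSimplex_succ {m : ℕ} {s : ℝ} (hs : 0 ≤ s)
    {f : (Fin (m + 1) → ℝ) → ℝ} (hf : Continuous f) :
    ∫ t in cornerSimplex (m + 1) s, f t =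
      ∫ r in (0 : ℝ)..s, ∫ t in cornerSimplex m (s - r), f (Fin.cons r t) := by
  have hS : MeasurableSet (cornerSimplex (m + 1) s) := (cornerSimplex_isCompact _ _).measurableSet
  set e := (MeasurableEquiv.piFinSuccAbove (fun _ : Fin (m + 1) => ℝ) 0).symm with he
  have hem : MeasurePreserving e :=
    (volume_preserving_piFinSuccAbove (fun _ : Fin (m + 1) => ℝ) 0).symm _
  have hcons : ∀ p, e p = Fin.cons p.1 p.2 := fun p => by
    simp only [he, MeasurableEquiv.piFinSuccAbove_symm_apply, Fin.insertNthEquiv,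
      Equiv.coe_fn_mk, Fin.insertNth_zero]
    rfl
  have hint : Integrable ((cornerSimplex (m + 1) s).indicator f) :=
    (integrable_indicator_iff hS).2 (hf.continuousOn.integrableOn_compact
      (cornerSimplex_isCompact _ _))
  have hint' : Integrable (fun p => (cornerSimplex (m + 1) s).indicator f (e p)) :=
    hem.integrable_comp_of_integrable hint
  rw [← integral_indicator hS, ← hem.integral_comp e.measurableEmbedding, Measure.volume_eq_prod,
    integral_prod _ (by simpa only [Measure.volume_eq_prod] using hint'),
    intervalIntegral.integral_of_le hs, ← integral_Icc_eq_integral_Ioc,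
    ← integral_indicator measurableSet_Icc]
  congr 1
  ext r
  have hin : ∀ t, (cornerSimplex (m + 1) s).indicator f (e (r, t)) =
      if 0 ≤ r then (cornerSimplex m (s - r)).indicator (fun t => f (Fin.cons r t)) t else 0 := by
    intro t
    rw [hcons]
    by_cases h : 0 ≤ r <;> by_cases h' : t ∈ cornerSimplex m (s - r) <;>
      simp [indicator, cons_mem_cornerSimplex, h, h']
  simp only [hin]
  by_cases h0 : 0 ≤ r
  · simp only [h0, if_true]
    rw [integral_indicator (cornerSimplex_isCompact _ _).measurableSet]
    by_cases h1 : r ≤ s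
    · rw [indicator_of_mem (show r ∈ Icc 0 s from ⟨h0, h1⟩)]
    · rw [indicator_of_notMem (fun h => h1 h.2), cornerSimplex_eq_empty (by linarith)]
      simp
  · rw [indicator_of_notMem (fun h => h0 h.1)]
    simp [h0]

theorem simplexForm_cons {m : ℕ} (s r : ℝ) (y : Fin (m + 2) → ℝ) (t : Fin m → ℝ) :
    simplexForm (m + 1) s y (Fin.cons r t) =
      r * y 0 + simplexForm m (s - r) (fun i => y i.succ) t := by
  simp only [simplexForm, Fin.sum_univ_succ, Fin.cons_zero, Fin.cons_succ, Fin.castSucc_zero,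
    Fin.succ_last, Fin.succ_castSucc]
  ring

@[fun_prop]
theorem continuous_simplexForm (m : ℕ) (s : ℝ) (y : Fin (m + 1) → ℝ) :
    Continuous (simplexForm m s y) := by
  unfold simplexForm; fun_prop

theorem simplexExpIntegral_succ {m : ℕ} {s : ℝ} (hs : 0 ≤ s) (y : Fin (m + 2) → ℝ) :
    simplexExpIntegral (m + 1) s y =
      ∫ r in (0 : ℝ)..s, Real.exp (r * y 0) * simplexExpIntegral m (s - r) fun i => y i.succ := by
  rw [simplexExpIntegral, setIntegral_cornerSimplex_succ hs (by fun_prop)]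
  congr 1
  ext r
  rw [simplexExpIntegral, ← integral_const_mul]
  congr 1
  ext t
  rw [simplexForm_cons, Real.exp_add]

theorem integral_one_cornerSimplex (m : ℕ) {s : ℝ} (hs : 0 ≤ s) :
    ∫ _ in cornerSimplex m s, (1 : ℝ) = s ^ m / m.factorial := by
  induction m generalizing s with
  | zero => rw [setIntegral_cornerSimplex_zero hs]; simp
  | succ m ih =>
    rw [setIntegral_cornerSimplex_succ hs continuous_const]
    have : ∫ r in (0 : ℝ)..s, ∫ _ in cornerSimplex m (s - r), (1 : ℝ) =
        ∫ r in (0 : ℝ)..s, (s - r) ^ m / m.factorial := by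
      refine intervalIntegral.integral_congr fun r hr => ?_
      rw [uIcc_of_le hs] at hr
      exact ih (sub_nonneg.2 hr.2)
    rw [this, intervalIntegral.integral_comp_sub_left (fun u => u ^ m / m.factorial) s]
    simp only [sub_self, sub_zero, intervalIntegral.integral_div, integral_pow]
    rw [Nat.factorial_succ]
    push_cast
    field_simp
    simp

theorem integral_simplexForm (m : ℕ) {s : ℝ} (hs : 0 ≤ s) (y : Fin (m + 1) → ℝ) :
    ∫ t in cornerSimplex m s, simplexForm m s y t =
      s ^ (m + 1) / (m + 1).factorial * ∑ i, y i := by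
  induction m generalizing s with
  | zero => rw [setIntegral_cornerSimplex_zero hs]; simp [simplexForm]
  | succ m ih =>
    rw [setIntegral_cornerSimplex_succ hs (by fun_prop)]
    -- Writing `r` as `s - (s - r)` makes the integrand a function of `s - r`, ready for the
    -- substitution.
    have : ∫ r in (0 : ℝ)..s, ∫ t in cornerSimplex m (s - r), simplexForm (m + 1) s y (Fin.cons r t) =
        ∫ r in (0 : ℝ)..s, ((s - (s - r)) * y 0 * ((s - r) ^ m / m.factorial) +
          (s - r) ^ (m + 1) / (m + 1).factorial * ∑ i : Fin (m + 1), y i.succ) := by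
      refine intervalIntegral.integral_congr fun r hr => ?_
      rw [uIcc_of_le hs] at hr
      simp only [simplexForm_cons]
      have hi : ∀ g : (Fin m → ℝ) → ℝ, Continuous g → IntegrableOn g (cornerSimplex m (s - r)) :=
        fun g hg => hg.continuousOn.integrableOn_compact (cornerSimplex_isCompact _ _)
      rw [integral_add (hi _ continuous_const) (hi _ (by fun_prop)), ih (sub_nonneg.2 hr.2),
        ← integral_one_cornerSimplex m (sub_nonneg.2 hr.2), ← integral_const_mul]
      simp
    rw [this, intervalIntegral.integral_comp_sub_left (fun u => (s - u) * y 0 * (u ^ m / m.factorial)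
      + u ^ (m + 1) / (m + 1).factorial * ∑ i : Fin (m + 1), y i.succ) s]
    have h2 : ∀ u : ℝ, (s - u) * y 0 * (u ^ m / m.factorial)
        + u ^ (m + 1) / (m + 1).factorial * ∑ i : Fin (m + 1), y i.succ =
        (s * y 0 / m.factorial) * u ^ m +
        ((∑ i : Fin (m + 1), y i.succ) / (m + 1).factorial - y 0 / m.factorial) * u ^ (m + 1) :=
      fun u => by ring
    simp only [h2, sub_self, sub_zero]
    rw [intervalIntegral.integral_add ((by fun_prop : Continuous _).intervalIntegrable _ _)
      ((by fun_prop : Continuous _).intervalIntegrable _ _),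
      intervalIntegral.integral_const_mul, intervalIntegral.integral_const_mul, integral_pow,
      integral_pow, Fin.sum_univ_succ (f := y), Nat.factorial_succ (m + 1), Nat.factorial_succ m]
    push_cast
    field_simp
    ring

/-! ### Divided differences of the exponential -/

theorem prod_erase_eq {ι : Type*} [Fintype ι] [DecidableEq ι] (i : ι) (f : ι → ℝ) :
    ∏ j ∈ Finset.univ.erase i, f j = ∏ j, if j = i then 1 else f j := by
  rw [← Finset.mul_prod_erase _ _ (Finset.mem_univ i), if_pos rfl, one_mul]
  exact Finset.prod_congr rfl fun j hj => by rw [if_neg (Finset.ne_of_mem_erase hj)]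

theorem prod_erase_zero {m : ℕ} (f : Fin (m + 1) → ℝ) :
    ∏ j ∈ Finset.univ.erase 0, f j = ∏ j : Fin m, f j.succ := by
  rw [prod_erase_eq, Fin.prod_univ_succ]
  simp [Fin.succ_ne_zero]

theorem prod_erase_succ {m : ℕ} (i : Fin m) (f : Fin (m + 1) → ℝ) :
    ∏ j ∈ Finset.univ.erase i.succ, f j = f 0 * ∏ j ∈ Finset.univ.erase i, f j.succ := by
  rw [prod_erase_eq, prod_erase_eq, Fin.prod_univ_succ]
  simp [(Fin.succ_ne_zero i).symm]

/-- Partial fractions: Lagrange interpolation of the constant `1` at the nodes `a`, evaluated at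
`b`. -/
theorem sum_inv_sub_mul_prod {m : ℕ} {a : Fin (m + 1) → ℝ} (ha : Function.Injective a) {b : ℝ}
    (hb : ∀ i, b ≠ a i) :
    ∑ i, ((b - a i) * ∏ j ∈ Finset.univ.erase i, (a i - a j))⁻¹ = (∏ i, (b - a i))⁻¹ := by
  have h := Lagrange.eval_interpolate_not_at_node (s := Finset.univ) (v := a) (x := b)
    (1 : Fin (m + 1) → ℝ) (fun i _ => hb i)
  rw [Lagrange.interpolate_one ha.injOn Finset.univ_nonempty, Polynomial.eval_one,
    Lagrange.eval_nodal] at h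
  refine Eq.trans ?_ (inv_eq_of_mul_eq_one_right h.symm).symm
  refine Finset.sum_congr rfl fun i _ => ?_
  simp only [Lagrange.nodalWeight, Finset.prod_inv_distrib, Pi.one_apply, mul_inv]
  ring

theorem integral_exp_mul_exp {a b : ℝ} (hab : b ≠ a) (s : ℝ) :
    ∫ r in (0 : ℝ)..s, Real.exp (r * b) * Real.exp ((s - r) * a) =
      (Real.exp (s * b) - Real.exp (s * a)) / (b - a) := by
  have h : ∀ r, Real.exp (r * b) * Real.exp ((s - r) * a) =
      Real.exp (s * a) * Real.exp (r * (b - a)) := fun r => by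
    rw [← Real.exp_add, ← Real.exp_add]; ring_nf
  simp only [h]
  rw [intervalIntegral.integral_const_mul,
    intervalIntegral.integral_comp_mul_right (fun r => Real.exp r) (sub_ne_zero.2 hab), integral_exp,
    smul_eq_mul, zero_mul, Real.exp_zero, mul_left_comm, mul_sub, ← Real.exp_add, mul_one]
  ring_nf

/-- The Hermite–Genocchi formula for `exp`, by induction on the number of nodes. -/
theorem simplexExpIntegral_eq (m : ℕ) {s : ℝ} (hs : 0 ≤ s) {y : Fin (m + 1) → ℝ}
    (hy : Function.Injective y) :
    simplexExpIntegral m s y =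
      ∑ i, Real.exp (s * y i) / ∏ j ∈ Finset.univ.erase i, (y i - y j) := by
  induction m generalizing s with
  | zero =>
    rw [simplexExpIntegral, setIntegral_cornerSimplex_zero hs]
    simp [simplexForm]
  | succ m ih =>
    have hy' : Function.Injective fun i : Fin (m + 1) => y i.succ :=
      fun i j h => Fin.succ_injective _ (hy h)
    have hne : ∀ i : Fin (m + 1), y 0 ≠ y i.succ := fun i h => Fin.succ_ne_zero i (hy h).symm
    rw [simplexExpIntegral_succ hs]
    have h1 : ∫ r in (0 : ℝ)..s, Real.exp (r * y 0) * simplexExpIntegral m (s - r) (fun i => y i.succ) =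
        ∫ r in (0 : ℝ)..s, ∑ i : Fin (m + 1), Real.exp (r * y 0) * Real.exp ((s - r) * y i.succ) *
          (∏ j ∈ Finset.univ.erase i, (y i.succ - y j.succ))⁻¹ := by
      refine intervalIntegral.integral_congr fun r hr => ?_
      rw [uIcc_of_le hs] at hr
      simp only [ih (sub_nonneg.2 hr.2) hy', Finset.mul_sum, div_eq_mul_inv, mul_assoc]
    rw [h1, intervalIntegral.integral_finsetSum fun i _ =>
      (by fun_prop : Continuous _).intervalIntegrable _ _]
    simp only [intervalIntegral.integral_mul_const, integral_exp_mul_exp (hne _)]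
    -- The coefficient of `exp (s * y 0)` is spread over the other nodes by partial fractions, so
    -- that the two sides can be compared term by term.
    rw [Fin.sum_univ_succ (n := m + 1), prod_erase_zero, div_eq_mul_inv (Real.exp (s * y 0)),
      ← sum_inv_sub_mul_prod hy' hne,
      Finset.mul_sum, ← Finset.sum_add_distrib]
    refine Finset.sum_congr rfl fun i _ => ?_
    rw [prod_erase_succ]
    have h2 : y 0 - y i.succ ≠ 0 := sub_ne_zero.2 (hne i)
    have h3 : y i.succ - y 0 ≠ 0 := sub_ne_zero.2 (hne i).symm
    have h4 : ∏ j ∈ Finset.univ.erase i, (y i.succ - y j.succ) ≠ 0 :=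
      Finset.prod_ne_zero_iff.2 fun j hj =>
        sub_ne_zero.2 fun h => (Finset.ne_of_mem_erase hj) (hy' h).symm
    rw [← neg_sub (y 0) (y i.succ)]
    field_simp
    ring

theorem continuous_simplexExpIntegral (m : ℕ) (s : ℝ) : Continuous (simplexExpIntegral m s) := by
  apply continuous_parametric_integral_of_continuous _ (cornerSimplex_isCompact m s)
  unfold simplexForm
  fun_prop

theorem simplexExpIntegral_const (m : ℕ) (c : ℝ) :
    simplexExpIntegral m 1 (fun _ => c) = Real.exp c / m.factorial := by
  have h : ∀ t, simplexForm m 1 (fun _ => c) t = c := fun t => by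
    simp only [simplexForm, ← Finset.sum_mul]; ring
  simp only [simplexExpIntegral, h]
  have := integral_one_cornerSimplex m zero_le_one
  rw [one_pow] at this
  rw [div_eq_mul_one_div, ← this, ← integral_const_mul]
  simp

/-! ### The continuous extensions -/

theorem ae_ne_of_linear {ι : Type*} [Fintype ι] {L : (ι → ℝ) →ₗ[ℝ] ℝ} (hL : L ≠ 0) :
    ∀ᵐ v : ι → ℝ, L v ≠ 0 := by
  rw [ae_iff]
  simp only [not_not]
  exact Measure.addHaar_submodule volume (LinearMap.ker L)
    fun h => hL (LinearMap.ker_eq_top.1 h)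

/-- The complement is a finite union of hyperplanes, which are null, and a conull set is dense. -/
theorem dense_injective_and_ne_zero {ι : Type*} [Fintype ι] :
    Dense {v : ι → ℝ | Function.Injective v ∧ ∀ j, v j ≠ 0} := by
  classical
  apply Measure.dense_of_ae (μ := (volume : Measure (ι → ℝ)))
  refine Filter.Eventually.and ?_ ?_
  · have : ∀ i j : ι, ∀ᵐ v : ι → ℝ, i ≠ j → v i ≠ v j := fun i j => by
      by_cases hij : i = j
      · simp [hij]
      · have hL : LinearMap.proj (R := ℝ) (φ := fun _ : ι => ℝ) i - LinearMap.proj j ≠ 0 := fun h => by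
          have := LinearMap.congr_fun h (Pi.single i 1)
          change (Pi.single i 1 : ι → ℝ) i - (Pi.single i 1 : ι → ℝ) j = 0 at this
          rw [Pi.single_eq_same, Pi.single_eq_of_ne (Ne.symm hij)] at this
          simp at this
        filter_upwards [ae_ne_of_linear hL] with v hv _ h
        exact hv (by simp [h])
    filter_upwards [ae_all_iff.2 fun i => ae_all_iff.2 (this i)] with v hv i j h
    by_contra hne
    exact hv i j hne h
  · refine ae_all_iff.2 fun j => ?_
    have hL : (LinearMap.proj j : (ι → ℝ) →ₗ[ℝ] ℝ) ≠ 0 := fun h => by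
      have := LinearMap.congr_fun h (Pi.single j 1)
      simp at this
    exact ae_ne_of_linear hL

theorem expSumFormula_reindex {ι κ : Type*} [Fintype ι] [DecidableEq ι] [Fintype κ]
    [DecidableEq κ] (e : κ ≃ ι) (y : ι → ℝ) :
    expSumFormula y = expSumFormula (y ∘ e) := by
  unfold expSumFormula
  rw [← e.sum_comp]
  refine Finset.sum_congr rfl fun i _ => ?_
  rw [prod_erase_eq, prod_erase_eq, ← e.prod_comp]
  simp

theorem expSum_eq_simplexExpIntegral {ι : Type*} [Fintype ι] [DecidableEq ι] {m : ℕ}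
    (e : Fin (m + 1) ≃ ι) (y : ι → ℝ) : expSum y = simplexExpIntegral m 1 (y ∘ e) := by
  apply extendFrom_eq
  · exact (dense_injective_and_ne_zero.mono fun v hv => hv.1) y
  · have hc : Continuous fun v : ι → ℝ => simplexExpIntegral m 1 (v ∘ e) :=
      (continuous_simplexExpIntegral m 1).comp
        (continuous_pi fun i => continuous_apply (e i))
    refine (hc.tendsto y).mono_left nhdsWithin_le_nhds |>.congr' ?_
    filter_upwards [self_mem_nhdsWithin] with v hv
    rw [expSumFormula_reindex e, simplexExpIntegral_eq m zero_le_one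
      (Function.Injective.comp hv e.injective)]
    simp [expSumFormula]

theorem Hformula_reindex {ι κ : Type*} [Fintype ι] [DecidableEq ι] [Fintype κ]
    [DecidableEq κ] (e : κ ≃ ι) (u : ι → ℝ) : Hformula u = Hformula (u ∘ e) := by
  unfold Hformula
  rw [← e.sum_comp, ← e.sum_comp, ← e.prod_comp, Fintype.card_congr e]
  congr 1
  refine Finset.sum_congr rfl fun i _ => ?_
  rw [prod_erase_eq, prod_erase_eq, ← e.prod_comp]
  simp

/-- This derivative is the first term of `Hformula`: the contribution of the double node `0` to a
divided difference. -/
theorem hasDerivAt_exp_div_prod {m : ℕ} {u : Fin m → ℝ} (hu : ∀ j, u j ≠ 0) :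
    HasDerivAt (fun s => Real.exp s / ∏ j, (s - u j))
      ((-1) ^ m * ((1 + ∑ j, (u j)⁻¹) / ∏ j, u j)) 0 := by
  have hp : HasDerivAt (fun s : ℝ => ∏ j, (s - u j))
      (∑ i, (∏ j ∈ Finset.univ.erase i, (0 - u j)) • (1 : ℝ)) 0 :=
    HasDerivAt.fun_finsetProd fun i _ => (hasDerivAt_id (0 : ℝ)).sub_const (u i)
  have hne : ∏ j, (0 - u j) ≠ 0 := Finset.prod_ne_zero_iff.2 fun j _ => by simpa using hu j
  have he : ∀ i, ∏ j ∈ Finset.univ.erase i, (0 - u j) = -(∏ j, (0 - u j)) * (u i)⁻¹ := fun i => by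
    rw [← Finset.mul_prod_erase _ _ (Finset.mem_univ i)]
    have := hu i
    field_simp
    ring
  have hprod : ∏ j, (0 - u j) = (-1) ^ m * ∏ j, u j := by
    simp [Finset.prod_neg]
  refine ((Real.hasDerivAt_exp 0).div hp hne).congr_deriv ?_
  simp only [he, smul_eq_mul, mul_one, ← Finset.mul_sum, Real.exp_zero]
  have hne2 : ∏ j, u j ≠ 0 := Finset.prod_ne_zero_iff.2 fun j _ => hu j
  have h1 : ((-1 : ℝ) ^ m) ^ 2 = 1 := by rw [← pow_mul, mul_comm, pow_mul]; simp
  have hs : (-1 : ℝ) ^ m ≠ 0 := by positivity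
  rw [hprod]
  field_simp
  rw [h1]
  ring

/-- Split the double node into `0` and `ε` and let `ε → 0`. The terms of the nodes `0` and `ε`
combine to a difference quotient of `exp s / ∏ (s - u j)`; the remaining terms converge by
continuity. -/
theorem Hformula_eq_simplexExpIntegral {m : ℕ} {u : Fin m → ℝ} (hu : Function.Injective u)
    (hu0 : ∀ j, u j ≠ 0) :
    Hformula u = simplexExpIntegral (m + 1) 1 (Fin.cons 0 (Fin.cons 0 u)) := by
  have hc : Filter.Tendsto
      (fun ε : ℝ => simplexExpIntegral (m + 1) 1 (Fin.cons 0 (Fin.cons ε u)))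
      (nhdsWithin 0 {0}ᶜ) (nhds (simplexExpIntegral (m + 1) 1 (Fin.cons 0 (Fin.cons 0 u)))) := by
    refine Filter.Tendsto.mono_left ?_ nhdsWithin_le_nhds
    refine ((continuous_simplexExpIntegral (m + 1) 1).comp (continuous_pi fun i => ?_)).tendsto 0
    refine Fin.cases ?_ (fun i => ?_) i
    · simpa using continuous_const
    · refine Fin.cases ?_ (fun i => ?_) i
      · simpa using continuous_id'
      · simpa using continuous_const
  refine tendsto_nhds_unique ?_ hc
  have h1 := hasDerivAt_iff_tendsto_slope.1 (hasDerivAt_exp_div_prod hu0)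
  have h2 : Filter.Tendsto (fun ε : ℝ => ∑ j, Real.exp (u j) /
      (u j * ((u j - ε) * ∏ k ∈ Finset.univ.erase j, (u j - u k)))) (nhdsWithin 0 {0}ᶜ)
      (nhds (∑ j, Real.exp (u j) / (u j ^ 2 * ∏ k ∈ Finset.univ.erase j, (u j - u k)))) := by
    refine Filter.Tendsto.mono_left ?_ nhdsWithin_le_nhds
    refine tendsto_finsetSum _ fun j _ => ?_
    have hP : ∏ k ∈ Finset.univ.erase j, (u j - u k) ≠ 0 :=
      Finset.prod_ne_zero_iff.2 fun k hk =>
        sub_ne_zero.2 fun h => (Finset.ne_of_mem_erase hk) (hu h).symm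
    have : ContinuousAt (fun ε : ℝ => Real.exp (u j) /
        (u j * ((u j - ε) * ∏ k ∈ Finset.univ.erase j, (u j - u k)))) 0 := by
      refine ContinuousAt.div (by fun_prop) (by fun_prop) ?_
      simpa [hu0 j] using hP
    convert! this.tendsto using 2
    ring
  have h3 := h1.add h2
  rw [Hformula, Fintype.card_fin]
  refine h3.congr' ?_
  have hev : ∀ᶠ ε : ℝ in nhdsWithin 0 {0}ᶜ, ∀ j, u j ≠ ε := by
    refine Filter.Eventually.filter_mono nhdsWithin_le_nhds ?_
    exact Filter.eventually_all.2 fun j => (isOpen_ne.eventually_mem (hu0 j).symm).mono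
      fun ε h => Ne.symm h
  filter_upwards [self_mem_nhdsWithin, hev] with ε hε hεu
  have hε0 : ε ≠ 0 := hε
  have hinj : Function.Injective (Fin.cons 0 (Fin.cons ε u : Fin (m + 1) → ℝ) : Fin (m + 2) → ℝ) := by
    refine Fin.cons_injective_iff.2 ⟨?_, Fin.cons_injective_iff.2 ⟨?_, hu⟩⟩
    · rintro ⟨i, hi⟩
      revert hi
      refine Fin.cases ?_ (fun i => ?_) i
      · simpa using hε0
      · simpa using hu0 i
    · rintro ⟨i, hi⟩
      exact hεu i hi
  rw [simplexExpIntegral_eq (m + 1) zero_le_one hinj, Fin.sum_univ_succ, Fin.sum_univ_succ]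
  simp only [prod_erase_zero, prod_erase_succ, Fin.prod_univ_succ, Fin.cons_zero, Fin.cons_succ,
    one_mul, sub_zero, slope_def_field, Real.exp_zero]
  rw [← add_assoc]
  congr 1
  rw [zero_sub, sub_div, div_div, div_div]
  rw [neg_mul, div_neg]
  ring

theorem H_zero {ι : Type*} [Fintype ι] [DecidableEq ι] :
    H (fun _ : ι => (0 : ℝ)) = 1 / ((Fintype.card ι + 1).factorial : ℝ) := by
  obtain ⟨m, hm⟩ : ∃ m, Fintype.card ι = m := ⟨_, rfl⟩
  rw [hm]
  let e : Fin m ≃ ι := (Fintype.equivFinOfCardEq hm).symm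
  apply extendFrom_eq
  · exact dense_injective_and_ne_zero _
  · have hc : Continuous fun v : ι → ℝ =>
        simplexExpIntegral (m + 1) 1 (Fin.cons 0 (Fin.cons 0 (v ∘ e))) := by
      refine (continuous_simplexExpIntegral (m + 1) 1).comp (continuous_pi fun i => ?_)
      refine Fin.cases ?_ (fun i => ?_) i
      · simpa using continuous_const
      · refine Fin.cases ?_ (fun i => ?_) i
        · simpa using continuous_const
        · simpa using continuous_apply (e i)
    have h := (hc.tendsto fun _ => 0).mono_left (nhdsWithin_le_nhds
      (s := {v : ι → ℝ | Function.Injective v ∧ ∀ j, v j ≠ 0}))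
    have hz : (Fin.cons 0 (Fin.cons 0 ((fun _ : ι => (0 : ℝ)) ∘ e) : Fin (m + 1) → ℝ) :
        Fin (m + 2) → ℝ) = fun _ => 0 := by
      ext i
      refine Fin.cases rfl (fun i => Fin.cases rfl (fun i => rfl) i) i
    rw [hz, simplexExpIntegral_const, Real.exp_zero] at h
    refine h.congr' ?_
    filter_upwards [self_mem_nhdsWithin] with v hv
    rw [Hformula_reindex e, Hformula_eq_simplexExpIntegral (hv.1.comp e.injective)
      fun j => hv.2 (e j)]

/-! ### Integrals over the cells of a triangulation -/

/-- Barycentric coordinates `(t_1, …, t_m, 1 - ∑ t_i)` of a point of the corner simplex. -/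
def baryCoords {m : ℕ} (t : Fin m → ℝ) : Fin (m + 1) → ℝ :=
  Fin.snoc (α := fun _ => ℝ) t (1 - ∑ i, t i)

theorem sum_baryCoords {m : ℕ} (t : Fin m → ℝ) : ∑ i, baryCoords t i = 1 := by
  simp [Fin.sum_univ_castSucc, baryCoords]

theorem baryCoords_nonneg_iff {m : ℕ} (t : Fin m → ℝ) :
    (∀ i, 0 ≤ baryCoords t i) ↔ t ∈ cornerSimplex m 1 := by
  simp [Fin.forall_fin_succ', baryCoords, cornerSimplex]

theorem simplexForm_eq_sum {m : ℕ} (y : Fin (m + 1) → ℝ) (t : Fin m → ℝ) :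
    simplexForm m 1 y t = ∑ i, baryCoords t i * y i := by
  simp [Fin.sum_univ_castSucc, baryCoords, simplexForm]

/-- Affine change of variables without determinants: by uniqueness of Haar measure the barycentric
parametrization scales Lebesgue measure by a constant, found by testing on `g = 1`. -/
theorem setIntegral_simplex {v : Fin (d + 1) → EuclideanSpace ℝ (Fin d)}
    (hv : AffineIndependent ℝ v) (g : EuclideanSpace ℝ (Fin d) → ℝ) :
    ∫ p in convexHull ℝ (range v), g p =
      d.factorial * volume.real (convexHull ℝ (range v)) *
        ∫ t in cornerSimplex d 1, g (∑ i, baryCoords t i • v i) := by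
  let L : (Fin d → ℝ) →ₗ[ℝ] EuclideanSpace ℝ (Fin d) :=
    Fintype.linearCombination ℝ fun i : Fin d => v i.castSucc - v (Fin.last d)
  have hA : ∀ t : Fin d → ℝ, ∑ i, baryCoords t i • v i = v (Fin.last d) + L t := fun t => by
    simp only [L, Fintype.linearCombination_apply, Fin.sum_univ_castSucc, baryCoords,
      Fin.snoc_castSucc, Fin.snoc_last, smul_sub, Finset.sum_sub_distrib, sub_smul, one_smul,
      ← Finset.sum_smul]
    abel
  have huniq : ∀ a b : Fin (d + 1) → ℝ, ∑ i, a i = 1 → ∑ i, b i = 1 →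
      ∑ i, a i • v i = ∑ i, b i • v i → a = b := fun a b ha hb hab => by
    ext i
    refine sub_eq_zero.1 ((affineIndependent_iff.1 hv) Finset.univ (fun i => a i - b i) ?_ ?_ i
      (Finset.mem_univ i))
    · rw [Finset.sum_sub_distrib, ha, hb, sub_self]
    · simp only [sub_smul, Finset.sum_sub_distrib, hab, sub_self]
  have hLinj : Function.Injective L := fun s t hst => by
    have h := huniq (baryCoords s) (baryCoords t) (sum_baryCoords s) (sum_baryCoords t)
      (by rw [hA, hA, hst])
    ext i
    simpa [baryCoords] using congrFun h i.castSucc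
  let Le : (Fin d → ℝ) ≃L[ℝ] EuclideanSpace ℝ (Fin d) :=
    (LinearEquiv.ofInjectiveOfFinrankEq L hLinj (by simp)).toContinuousLinearEquiv
  have hLe : ∀ t, Le t = L t := fun t => rfl
  obtain ⟨K, hK⟩ : ∃ K : NNReal, (volume.map Le) = K • (volume : Measure (EuclideanSpace ℝ (Fin d))) :=
    ⟨_, Measure.isAddLeftInvariant_eq_smul (volume.map Le) volume⟩
  let A : (Fin d → ℝ) ≃ₜ EuclideanSpace ℝ (Fin d) :=
    Le.toHomeomorph.trans (Homeomorph.addLeft (v (Fin.last d)))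
  have hAt : ∀ t, A t = ∑ i, baryCoords t i • v i := fun t => by rw [hA]; rfl
  have hmap : (volume.map A) = K • (volume : Measure (EuclideanSpace ℝ (Fin d))) := by
    have : (A : (Fin d → ℝ) → EuclideanSpace ℝ (Fin d)) = (fun p => v (Fin.last d) + p) ∘ Le := rfl
    rw [this, ← Measure.map_map (measurable_const_add _) Le.continuous.measurable, hK,
      Measure.map_smul, map_add_left_eq_self]
  have hpre : A ⁻¹' convexHull ℝ (range v) = cornerSimplex d 1 := by
    ext t
    rw [mem_preimage, hAt, mem_convexHull_range_iff, ← baryCoords_nonneg_iff]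
    constructor
    · rintro ⟨a, ha, ha1, hat⟩
      rwa [← huniq a _ ha1 (sum_baryCoords t) hat]
    · exact fun h => ⟨_, h, sum_baryCoords t, rfl⟩
  have key : ∀ g : EuclideanSpace ℝ (Fin d) → ℝ,
      ∫ t in cornerSimplex d 1, g (∑ i, baryCoords t i • v i) =
        K * ∫ p in convexHull ℝ (range v), g p := fun g => by
    have h := A.measurableEmbedding.setIntegral_map (μ := volume) g (convexHull ℝ (range v))
    rw [hmap, hpre, Measure.restrict_smul, integral_smul_nnreal_measure] at h
    simp only [hAt] at h
    rw [← h]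
    rfl
  have h1 := key fun _ => 1
  rw [integral_one_cornerSimplex d zero_le_one] at h1
  simp only [one_pow, setIntegral_const, smul_eq_mul, mul_one] at h1
  rw [key]
  have hd : (d.factorial : ℝ) ≠ 0 := by positivity
  have : d.factorial * volume.real (convexHull ℝ (range v)) * (K : ℝ) = 1 := by
    rw [mul_assoc, mul_comm (volume.real _), ← h1]
    field_simp
  rw [← mul_assoc, this, one_mul]

namespace IsRegularTriangulation

variable {x : Fin n → EuclideanSpace ℝ (Fin d)} {Δ : Finset (Finset (Fin n))}

theorem setIntegral_cell (h : IsRegularTriangulation x Δ) {σ : Finset (Fin n)} (hσ : σ ∈ Δ)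
    (e : Fin (d + 1) ≃ σ) (l : EuclideanSpace ℝ (Fin d) →ᵃ[ℝ] ℝ) (φ : ℝ → ℝ) :
    ∫ t in cellHull x σ, φ (l t) =
      normVol x σ * ∫ t in cornerSimplex d 1, φ (simplexForm d 1 (fun i => l (x (e i))) t) := by
  have hv : AffineIndependent ℝ fun i => x (e i) :=
    (h.affineIndependent hσ).comp_embedding e.toEmbedding
  have hr : range (fun i => x (e i)) = x '' (σ : Set (Fin n)) := by
    ext t
    constructor
    · rintro ⟨i, rfl⟩
      exact ⟨e i, (e i).2, rfl⟩
    · rintro ⟨i, hi, rfl⟩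
      exact ⟨e.symm ⟨i, hi⟩, by simp⟩
  have := setIntegral_simplex hv fun t => φ (l t)
  rw [hr] at this
  rw [cellHull, this, normVol]
  congr 2
  ext t
  rw [simplexForm_eq_sum, affine_map_sum l (sum_baryCoords t)]

theorem exists_equiv (h : IsRegularTriangulation x Δ) {σ : Finset (Fin n)} (hσ : σ ∈ Δ) :
    Nonempty (Fin (d + 1) ≃ σ) :=
  ⟨(Fintype.equivFinOfCardEq (by simpa using h.card_cell hσ)).symm⟩

theorem setIntegral_exp_cell (h : IsRegularTriangulation x Δ) {σ : Finset (Fin n)} (hσ : σ ∈ Δ)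
    {y : Fin n → ℝ} {l : EuclideanSpace ℝ (Fin d) →ᵃ[ℝ] ℝ} (hl : ∀ i ∈ σ, l (x i) = y i) :
    ∫ t in cellHull x σ, Real.exp (l t) = normVol x σ * expSum fun i : {i // i ∈ σ} => y i := by
  obtain ⟨e⟩ := h.exists_equiv hσ
  rw [h.setIntegral_cell hσ e, expSum_eq_simplexExpIntegral e]
  simp only [hl _ (e _).2]
  rfl

theorem setIntegral_affine_cell (h : IsRegularTriangulation x Δ) {σ : Finset (Fin n)} (hσ : σ ∈ Δ)
    {y : Fin n → ℝ} {l : EuclideanSpace ℝ (Fin d) →ᵃ[ℝ] ℝ} (hl : ∀ i ∈ σ, l (x i) = y i) :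
    ((d + 1).factorial : ℝ) * ∫ t in cellHull x σ, l t = normVol x σ * ∑ i ∈ σ, y i := by
  obtain ⟨e⟩ := h.exists_equiv hσ
  have h1 := h.setIntegral_cell hσ e l id
  simp only [id, integral_simplexForm d zero_le_one] at h1
  rw [h1, ← Finset.sum_coe_sort σ y, ← e.sum_comp fun i : σ => y i]
  simp only [hl _ (e _).2, one_pow]
  field_simp

theorem exists_interpolation (h : IsRegularTriangulation x Δ) {σ : Finset (Fin n)} (hσ : σ ∈ Δ)
    (y : Fin n → ℝ) : ∃ l : EuclideanSpace ℝ (Fin d) →ᵃ[ℝ] ℝ, ∀ i ∈ σ, l (x i) = y i := by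
  classical
  let b : AffineBasis σ ℝ (EuclideanSpace ℝ (Fin d)) :=
    ⟨fun i => x i, h.affineIndependent hσ, by
      rw [(h.affineIndependent hσ).affineSpan_eq_top_iff_card_eq_finrank_add_one]
      simpa using h.card_cell hσ⟩
  have hb : ∀ i : σ, b i = x i := fun _ => rfl
  refine ⟨(Fintype.linearCombination ℝ fun i : σ => y i).toAffineMap.comp b.coords, fun i hi => ?_⟩
  rw [← hb ⟨i, hi⟩]
  simp [Fintype.linearCombination_apply, AffineBasis.coord_apply]

theorem affine_le_tent_on_cell {σ : Finset (Fin n)}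
    {y : Fin n → ℝ} {l : EuclideanSpace ℝ (Fin d) →ᵃ[ℝ] ℝ} (hl : ∀ i ∈ σ, l (x i) = y i)
    {t : EuclideanSpace ℝ (Fin d)} (ht : t ∈ cellHull x σ) : l t ≤ tent x y t := by
  suffices cellHull x σ ⊆ {t ∈ polytope x | l t ≤ tent x y t} from (this ht).2
  apply convexHull_min
  · rintro _ ⟨i, hi, rfl⟩
    exact ⟨vertex_mem_polytope x i, (hl i hi).trans_le (le_tent_vertex x y i)⟩
  · rintro p ⟨hp, hpl⟩ q ⟨hq, hql⟩ r s hr hs hrs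
    refine ⟨polytope_convex x hp hq hr hs hrs, ?_⟩
    rw [Convex.combo_affine_apply hrs]
    exact (add_le_add (mul_le_mul_of_nonneg_left hpl hr)
      (mul_le_mul_of_nonneg_left hql hs)).trans ((tent_concaveOn x y).2 hp hq hr hs hrs)

/-- On the secondary cone the affine function interpolating `y` on a cell bounds the tent from above
everywhere on `P` and from below on that cell. -/
theorem integral_exp_tent (h : IsRegularTriangulation x Δ) {y : Fin n → ℝ}
    (hy : y ∈ secondaryCone x Δ) :
    ∫ t in polytope x, Real.exp (tent x y t) =
      ∑ σ ∈ Δ, normVol x σ * expSum fun i : {i // i ∈ σ} => y i := by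
  rw [h.setIntegral_polytope (comp_tent_integrableOn x y Real.continuous_exp)]
  refine Finset.sum_congr rfl fun σ hσ => ?_
  obtain ⟨l, hl, hl'⟩ := hy σ hσ
  rw [← h.setIntegral_exp_cell hσ hl]
  refine setIntegral_congr_fun (cellHull_isCompact x σ).measurableSet fun t ht => ?_
  exact congrArg Real.exp (le_antisymm (tent_le_affine x y hl' (cellHull_subset_polytope x σ ht))
    (affine_le_tent_on_cell hl ht))

/-! ### GKZ vectors as linear functionals -/

theorem sum_gkz_mul (x : Fin n → EuclideanSpace ℝ (Fin d)) (Δ : Finset (Finset (Fin n)))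
    (y : Fin n → ℝ) : ∑ k, gkz x Δ k * y k = ∑ σ ∈ Δ, normVol x σ * ∑ i ∈ σ, y i := by
  classical
  simp only [gkz, Finset.sum_filter, Finset.sum_mul, ite_mul, zero_mul]
  rw [Finset.sum_comm]
  refine Finset.sum_congr rfl fun σ _ => ?_
  rw [Finset.mul_sum, ← Finset.sum_filter]
  simp

/-- The left side is `(d + 1)!` times the integral of the piecewise affine interpolant of `y`, which
concavity keeps below the tent on each cell. Here `y` is arbitrary, not confined to the secondary
cone. -/
theorem sum_gkz_mul_le (h : IsRegularTriangulation x Δ) (y : Fin n → ℝ) :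
    ∑ k, gkz x Δ k * y k ≤ (d + 1).factorial * ∫ t in polytope x, tent x y t := by
  have hi := comp_tent_integrableOn x y continuous_id
  rw [sum_gkz_mul, h.setIntegral_polytope (g := tent x y) hi, Finset.mul_sum]
  refine Finset.sum_le_sum fun σ hσ => ?_
  obtain ⟨l, hl⟩ := h.exists_interpolation hσ y
  rw [← h.setIntegral_affine_cell hσ hl]
  refine mul_le_mul_of_nonneg_left ?_ (by positivity)
  exact setIntegral_mono_on
    (l.continuous_of_finiteDimensional.continuousOn.integrableOn_compact (cellHull_isCompact x σ))
    (hi.mono_set (cellHull_subset_polytope x σ)) (cellHull_isCompact x σ).measurableSet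
    fun t ht => affine_le_tent_on_cell hl ht

theorem sum_gkz (h : IsRegularTriangulation x Δ) :
    ∑ k, gkz x Δ k = (d + 1).factorial * volume.real (polytope x) := by
  have h1 := h.setIntegral_polytope (g := fun _ => (1 : ℝ))
    (continuous_const.continuousOn.integrableOn_compact (polytope_isCompact x))
  have h2 := sum_gkz_mul x Δ fun _ => 1
  simp only [mul_one] at h2
  simp only [setIntegral_const, smul_eq_mul, mul_one] at h1
  rw [h2, h1, Finset.mul_sum]
  refine Finset.sum_congr rfl fun σ hσ => ?_
  rw [Finset.sum_const, h.card_cell hσ, normVol, Nat.factorial_succ]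
  push_cast
  simp
  ring

theorem gkz_nonneg (x : Fin n → EuclideanSpace ℝ (Fin d)) (Δ : Finset (Finset (Fin n)))
    (k : Fin n) : 0 ≤ gkz x Δ k :=
  Finset.sum_nonneg fun _ _ => mul_nonneg (by positivity) measureReal_nonneg

theorem gkz_pos (h : IsRegularTriangulation x Δ) {σ : Finset (Fin n)} (hσ : σ ∈ Δ) {k : Fin n}
    (hk : k ∈ σ) : 0 < gkz x Δ k :=
  Finset.sum_pos (fun _ hτ => h.normVol_pos (Finset.mem_filter.1 hτ).1)
    ⟨σ, Finset.mem_filter.2 ⟨hσ, hk⟩⟩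

theorem polytope_subset_hull_gkz_pos (hfull : affineSpan ℝ (range x) = ⊤)
    (h : IsRegularTriangulation x Δ) :
    polytope x ⊆ convexHull ℝ (x '' {k | 0 < gkz x Δ k}) := by
  rw [h.polytope_eq_iUnion hfull]
  exact iUnion_subset fun σ => convexHull_mono (image_mono fun k hk => h.gkz_pos σ.2 hk)

theorem weightVector_const (h : IsRegularTriangulation x Δ) (c : ℝ) :
    weightVector x Δ (fun _ => c) = (Real.exp c / ((d + 1).factorial : ℝ)) • gkz x Δ := by
  ext k
  simp only [weightVector, gkz, sub_self, Pi.smul_apply, smul_eq_mul, Finset.mul_sum]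
  refine Finset.sum_congr rfl fun σ hσ => ?_
  obtain ⟨hσ, hk⟩ := Finset.mem_filter.1 hσ
  rw [H_zero, Fintype.card_coe, Finset.card_erase_of_mem hk, h.card_cell hσ]
  simp only [Nat.add_sub_cancel]
  ring

end IsRegularTriangulation

theorem sum_mul_le_of_mem_secondaryPolytope {x : Fin n → EuclideanSpace ℝ (Fin d)}
    {z : Fin n → ℝ} (hz : z ∈ secondaryPolytope x) (y : Fin n → ℝ) :
    ∑ k, z k * y k ≤ (d + 1).factorial * ∫ t in polytope x, tent x y t := by
  have hsub : secondaryPolytope x ⊆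
      {z | ∑ k, z k * y k ≤ (d + 1).factorial * ∫ t in polytope x, tent x y t} := by
    apply convexHull_min
    · rintro _ ⟨Δ, hΔ, rfl⟩
      exact hΔ.sum_gkz_mul_le y
    · exact convex_halfSpace_le ⟨fun a b => by simp [add_mul, Finset.sum_add_distrib],
        fun a b => by simp [Finset.mul_sum, mul_assoc]⟩ _
  exact hsub hz

theorem sum_of_mem_secondaryPolytope {x : Fin n → EuclideanSpace ℝ (Fin d)}
    {z : Fin n → ℝ} (hz : z ∈ secondaryPolytope x) :
    ∑ k, z k = (d + 1).factorial * volume.real (polytope x) := by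
  have hsub : secondaryPolytope x ⊆
      {z | ∑ k, z k = (d + 1).factorial * volume.real (polytope x)} := by
    apply convexHull_min
    · rintro _ ⟨Δ, hΔ, rfl⟩
      exact hΔ.sum_gkz
    · exact convex_hyperplane ⟨fun a b => by simp [Finset.sum_add_distrib],
        fun a b => by simp [Finset.mul_sum]⟩ _
  exact hsub hz

theorem nonneg_and_subset_of_mem_secondaryPolytope {x : Fin n → EuclideanSpace ℝ (Fin d)}
    (hfull : affineSpan ℝ (range x) = ⊤) {z : Fin n → ℝ} (hz : z ∈ secondaryPolytope x) :
    (∀ k, 0 ≤ z k) ∧ polytope x ⊆ convexHull ℝ (x '' {k | 0 < z k}) := by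
  have hsub : secondaryPolytope x ⊆
      {z | (∀ k, 0 ≤ z k) ∧ polytope x ⊆ convexHull ℝ (x '' {k | 0 < z k})} := by
    apply convexHull_min
    · rintro _ ⟨Δ, hΔ, rfl⟩
      exact ⟨IsRegularTriangulation.gkz_nonneg x Δ, hΔ.polytope_subset_hull_gkz_pos hfull⟩
    · rintro p ⟨hp, hp'⟩ q ⟨hq, hq'⟩ a b ha hb hab
      refine ⟨fun k => add_nonneg (mul_nonneg ha (hp k)) (mul_nonneg hb (hq k)), ?_⟩
      -- If `a > 0` the support of the combination contains that of `p`; if `a = 0` the combination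
      -- is `q` itself.
      rcases ha.eq_or_lt with rfl | ha
      · obtain rfl : b = 1 := by linarith
        simpa using hq'
      · refine hp'.trans (convexHull_mono (image_mono fun k hk => ?_))
        exact add_pos_of_pos_of_nonneg (mul_pos ha hk) (mul_nonneg hb (hq k))
  exact hsub hz

/-! ### Weights in the cone over the secondary polytope -/

theorem cone_nonneg {x : Fin n → EuclideanSpace ℝ (Fin d)} (hfull : affineSpan ℝ (range x) = ⊤)
    {w : Fin n → ℝ} (hw : w ∈ coneOverSecondaryPolytope x) (k : Fin n) : 0 ≤ w k := by
  obtain ⟨r, hr, z, hz, rfl⟩ := hw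
  exact mul_nonneg hr ((nonneg_and_subset_of_mem_secondaryPolytope hfull hz).1 k)

theorem cone_polytope_subset {x : Fin n → EuclideanSpace ℝ (Fin d)}
    (hfull : affineSpan ℝ (range x) = ⊤) {w : Fin n → ℝ}
    (hw : w ∈ coneOverSecondaryPolytope x) (hw0 : w ≠ 0) :
    polytope x ⊆ convexHull ℝ (x '' {k | 0 < w k}) := by
  obtain ⟨r, hr, z, hz, rfl⟩ := hw
  have hr : 0 < r := hr.lt_of_ne' fun h => hw0 (by rw [h, zero_smul])
  refine (nonneg_and_subset_of_mem_secondaryPolytope hfull hz).2.trans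
    (convexHull_mono (image_mono fun k hk => mul_pos hr hk))

theorem cone_sum_mul_le {x : Fin n → EuclideanSpace ℝ (Fin d)}
    (hfull : affineSpan ℝ (range x) = ⊤) {w : Fin n → ℝ}
    (hw : w ∈ coneOverSecondaryPolytope x) (y : Fin n → ℝ) :
    ∑ k, w k * y k ≤
      (∑ k, w k) * ((volume.real (polytope x))⁻¹ * ∫ t in polytope x, tent x y t) := by
  obtain ⟨r, hr, z, hz, rfl⟩ := hw
  have h1 := mul_le_mul_of_nonneg_left (sum_mul_le_of_mem_secondaryPolytope hz y) hr
  have h2 := (volume_polytope_pos hfull).ne'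
  simp only [Pi.smul_apply, smul_eq_mul, mul_assoc, ← Finset.mul_sum,
    sum_of_mem_secondaryPolytope hz]
  rwa [mul_inv_cancel_left₀ h2]

/-! ### The fundamental inequality and its equality case -/

theorem setIntegral_exp_tent_sub_tangent {x : Fin n → EuclideanSpace ℝ (Fin d)} {c : ℝ}
    (hc : Real.exp c * volume.real (polytope x) = 1) (y : Fin n → ℝ) :
    ∫ t in polytope x, (Real.exp (tent x y t) - Real.exp c * (tent x y t - c + 1)) =
      (∫ t in polytope x, Real.exp (tent x y t)) - (1 - c) -
        (volume.real (polytope x))⁻¹ * ∫ t in polytope x, tent x y t := by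
  have h1 := comp_tent_integrableOn x y Real.continuous_exp
  have h2 : IntegrableOn (tent x y) (polytope x) := comp_tent_integrableOn x y continuous_id
  have h3 : IntegrableOn (fun _ => Real.exp c * (1 - c)) (polytope x) :=
    continuous_const.continuousOn.integrableOn_compact (polytope_isCompact x)
  have h4 : ∀ t, Real.exp (tent x y t) - Real.exp c * (tent x y t - c + 1) =
      Real.exp (tent x y t) - Real.exp c * (1 - c) - Real.exp c * tent x y t := fun t => by ring
  have h5 : IntegrableOn (fun t => Real.exp (tent x y t) - Real.exp c * (1 - c)) (polytope x) :=
    h1.sub h3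
  simp only [h4]
  rw [integral_sub h5 (h2.const_mul _), integral_sub h1 h3, setIntegral_const,
    smul_eq_mul, ← eq_inv_of_mul_eq_one_left hc, ← mul_assoc, mul_comm (volume.real _), hc,
    one_mul, integral_const_mul]

/-- The graph of `exp` lies above its tangent line at `c`. -/
theorem exp_sub_tangent_nonneg (c s : ℝ) : 0 ≤ Real.exp s - Real.exp c * (s - c + 1) := by
  have h := mul_le_mul_of_nonneg_left (Real.add_one_le_exp (s - c)) (Real.exp_pos c).le
  rw [← Real.exp_add, add_sub_cancel] at h
  linarith

theorem eq_of_exp_sub_tangent_eq_zero {c s : ℝ}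
    (h : Real.exp s - Real.exp c * (s - c + 1) = 0) : s = c := by
  by_contra hne
  have h' := mul_lt_mul_of_pos_left (Real.add_one_lt_exp (sub_ne_zero.2 hne)) (Real.exp_pos c)
  rw [← Real.exp_add, add_sub_cancel] at h'
  linarith

theorem mean_tent_le {x : Fin n → EuclideanSpace ℝ (Fin d)} {c : ℝ}
    (hc : Real.exp c * volume.real (polytope x) = 1) (y : Fin n → ℝ) :
    (volume.real (polytope x))⁻¹ * ∫ t in polytope x, tent x y t ≤
      c - 1 + ∫ t in polytope x, Real.exp (tent x y t) := by
  have h : 0 ≤ ∫ t in polytope x, (Real.exp (tent x y t) - Real.exp c * (tent x y t - c + 1)) :=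
    integral_nonneg fun t => exp_sub_tangent_nonneg c _
  rw [setIntegral_exp_tent_sub_tangent hc] at h
  linarith

theorem tent_eq_of_mean_tent_eq {x : Fin n → EuclideanSpace ℝ (Fin d)} {c : ℝ}
    (hc : Real.exp c * volume.real (polytope x) = 1) {y : Fin n → ℝ}
    (h : (volume.real (polytope x))⁻¹ * ∫ t in polytope x, tent x y t =
      c - 1 + ∫ t in polytope x, Real.exp (tent x y t)) :
    tent x y =ᵐ[volume.restrict (polytope x)] fun _ => c := by
  have h0 : ∫ t in polytope x, (Real.exp (tent x y t) - Real.exp c * (tent x y t - c + 1)) = 0 := by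
    rw [setIntegral_exp_tent_sub_tangent hc]
    linarith
  rw [integral_eq_zero_iff_of_nonneg (fun t => exp_sub_tangent_nonneg c _)
    (comp_tent_integrableOn x y
      (φ := fun s => Real.exp s - Real.exp c * (s - c + 1)) (by fun_prop))] at h0
  filter_upwards [h0] with t ht
  exact eq_of_exp_sub_tangent_eq_zero ht

/-- Continuity gives equality with `c` on the interior. A larger value at a frontier point would, by
concavity, exceed `c` at the midpoint with an interior point. -/
theorem tent_le_of_ae_eq {x : Fin n → EuclideanSpace ℝ (Fin d)}
    (hfull : affineSpan ℝ (range x) = ⊤) {c : ℝ} {y : Fin n → ℝ}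
    (h : tent x y =ᵐ[volume.restrict (polytope x)] fun _ => c)
    {t : EuclideanSpace ℝ (Fin d)} (ht : t ∈ polytope x) : tent x y t ≤ c := by
  rw [← restrict_interior_polytope] at h
  have hint : EqOn (tent x y) (fun _ => c) (interior (polytope x)) :=
    Measure.eqOn_open_of_ae_eq h isOpen_interior (tent_concaveOn x y).continuousOn_interior
      continuousOn_const
  obtain ⟨p, hp⟩ := polytope_interior_nonempty hfull
  have hm := (polytope_convex x).combo_interior_self_mem_interior hp ht
    (by norm_num : (0 : ℝ) < 1 / 2) (by norm_num : (0 : ℝ) ≤ 1 / 2) (by norm_num)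
  have h2 := (tent_concaveOn x y).2 (interior_subset hp) ht (by norm_num : (0 : ℝ) ≤ 1 / 2)
    (by norm_num : (0 : ℝ) ≤ 1 / 2) (by norm_num)
  rw [hint hm, hint hp] at h2
  simp only [smul_eq_mul] at h2
  linarith

theorem cone_sum_pos {x : Fin n → EuclideanSpace ℝ (Fin d)} (hfull : affineSpan ℝ (range x) = ⊤)
    {w : Fin n → ℝ} (hw : w ∈ coneOverSecondaryPolytope x) (hw0 : w ≠ 0) : 0 < ∑ k, w k := by
  obtain ⟨k, hk⟩ := Function.ne_iff.1 hw0
  exact Finset.sum_pos' (fun i _ => cone_nonneg hfull hw i)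
    ⟨k, Finset.mem_univ k, (cone_nonneg hfull hw k).lt_of_ne' hk⟩

theorem cone_sum_mul_le_integral_exp {x : Fin n → EuclideanSpace ℝ (Fin d)}
    (hfull : affineSpan ℝ (range x) = ⊤) {c : ℝ}
    (hc : Real.exp c * volume.real (polytope x) = 1) {w : Fin n → ℝ}
    (hw : w ∈ coneOverSecondaryPolytope x) (y : Fin n → ℝ) :
    ∑ k, w k * y k ≤ (∑ k, w k) * (c - 1 + ∫ t in polytope x, Real.exp (tent x y t)) :=
  (cone_sum_mul_le hfull hw y).trans (mul_le_mul_of_nonneg_left (mean_tent_le hc y)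
    (Finset.sum_nonneg fun k _ => cone_nonneg hfull hw k))

theorem eq_const_of_sum_mul_eq {x : Fin n → EuclideanSpace ℝ (Fin d)}
    (hfull : affineSpan ℝ (range x) = ⊤) {c : ℝ}
    (hc : Real.exp c * volume.real (polytope x) = 1) {w : Fin n → ℝ}
    (hw : w ∈ coneOverSecondaryPolytope x) (hw0 : w ≠ 0) {y : Fin n → ℝ}
    (h : (∑ k, w k) * (c - 1 + ∫ t in polytope x, Real.exp (tent x y t)) ≤ ∑ k, w k * y k)
    (hy : (∀ i, 0 < w i) ∨ IsRelevant x y) : y = fun _ => c := by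
  have hW := cone_sum_pos hfull hw hw0
  have hae := tent_eq_of_mean_tent_eq hc (y := y) (le_antisymm (mean_tent_le hc y)
    (le_of_mul_le_mul_left (h.trans (cone_sum_mul_le hfull hw y)) hW))
  have hle : ∀ t ∈ polytope x, tent x y t ≤ c := fun t ht => tent_le_of_ae_eq hfull hae ht
  have hyc : ∀ i, y i ≤ c := fun i => (le_tent_vertex x y i).trans (hle _ (vertex_mem_polytope x i))
  have hI : ∫ t in polytope x, Real.exp (tent x y t) = 1 := by
    have : ∫ t in polytope x, Real.exp (tent x y t) = ∫ _ in polytope x, Real.exp c :=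
      integral_congr_ae (hae.mono fun t ht => congrArg Real.exp ht)
    rw [this, setIntegral_const, smul_eq_mul, mul_comm, hc]
  -- All terms are nonnegative, so each one vanishes: `y` equals `c` on the support of `w`.
  have hsum : ∑ k, w k * (c - y k) ≤ 0 := by
    rw [hI, sub_add_cancel] at h
    simp only [mul_sub, Finset.sum_sub_distrib, ← Finset.sum_mul]
    linarith
  have hzero : ∀ k, w k * (c - y k) = 0 := fun k => by
    have hn : ∀ i ∈ Finset.univ, 0 ≤ w i * (c - y i) := fun i _ =>
      mul_nonneg (cone_nonneg hfull hw i) (sub_nonneg.2 (hyc i))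
    exact (Finset.sum_eq_zero_iff_of_nonneg hn).1 (le_antisymm hsum (Finset.sum_nonneg hn)) k
      (Finset.mem_univ k)
  have heq : ∀ k, 0 < w k → y k = c := fun k hk => by
    rcases mul_eq_zero.1 (hzero k) with h | h
    · exact absurd h hk.ne'
    · linarith
  rcases hy with hpos | hrel
  · exact funext fun k => heq k (hpos k)
  -- A superlevel set of the tent is convex and contains the points of positive weight, whose hull
  -- is all of `P`.
  · have hge : polytope x ⊆ {t ∈ polytope x | c ≤ tent x y t} := by
      refine (cone_polytope_subset hfull hw hw0).trans (convexHull_min ?_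
        ((tent_concaveOn x y).convex_ge c))
      rintro _ ⟨k, hk, rfl⟩
      exact ⟨vertex_mem_polytope x k, (heq k hk).ge.trans (le_tent_vertex x y k)⟩
    ext i
    rw [← hrel i]
    exact le_antisymm (hle _ (vertex_mem_polytope x i)) (hge (vertex_mem_polytope x i)).2

theorem integral_exp_tent_const {x : Fin n → EuclideanSpace ℝ (Fin d)} {c : ℝ}
    (hc : Real.exp c * volume.real (polytope x) = 1) :
    ∫ t in polytope x, Real.exp (tent x (fun _ => c) t) = 1 := by
  rw [setIntegral_congr_fun (polytope_isCompact x).measurableSet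
    fun t ht => congrArg Real.exp (tent_const x c ht), setIntegral_const, smul_eq_mul, mul_comm, hc]

/-! ### Linear optimization over the Samworth body and the unconstrained problems -/

theorem isOptimalConstrained_const {x : Fin n → EuclideanSpace ℝ (Fin d)}
    (hfull : affineSpan ℝ (range x) = ⊤) {c : ℝ}
    (hc : Real.exp c * volume.real (polytope x) = 1) {w : Fin n → ℝ}
    (hw : w ∈ coneOverSecondaryPolytope x) : IsOptimalConstrained x w fun _ => c := by
  refine ⟨(integral_exp_tent_const hc).le, fun y hy => ?_⟩
  have hy : ∫ t in polytope x, Real.exp (tent x y t) ≤ 1 := hy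
  change ∑ i, w i * y i ≤ ∑ i, w i * c
  rw [← Finset.sum_mul]
  refine (cone_sum_mul_le_integral_exp hfull hc hw y).trans (mul_le_mul_of_nonneg_left ?_
    (Finset.sum_nonneg fun k _ => cone_nonneg hfull hw k))
  linarith

theorem eq_const_of_isOptimalConstrained {x : Fin n → EuclideanSpace ℝ (Fin d)}
    (hfull : affineSpan ℝ (range x) = ⊤) {c : ℝ}
    (hc : Real.exp c * volume.real (polytope x) = 1) {w : Fin n → ℝ}
    (hw : w ∈ coneOverSecondaryPolytope x) (hw0 : w ≠ 0) {y : Fin n → ℝ}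
    (h : IsOptimalConstrained x w y) (hy : (∀ i, 0 < w i) ∨ IsRelevant x y) :
    y = fun _ => c := by
  refine eq_const_of_sum_mul_eq hfull hc hw hw0 ?_ hy
  have h1 : ∑ i, w i * c ≤ ∑ i, w i * y i := h.2 (isOptimalConstrained_const hfull hc hw).1
  have h2 : ∫ t in polytope x, Real.exp (tent x y t) ≤ 1 := h.1
  rw [← Finset.sum_mul] at h1
  refine le_trans (mul_le_mul_of_nonneg_left ?_ (cone_sum_pos hfull hw hw0).le) h1
  linarith

theorem isOptimalUnconstrained_const {x : Fin n → EuclideanSpace ℝ (Fin d)}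
    (hfull : affineSpan ℝ (range x) = ⊤) {c : ℝ}
    (hc : Real.exp c * volume.real (polytope x) = 1) {w : Fin n → ℝ}
    (hw : w ∈ coneOverSecondaryPolytope x) (hw1 : ∑ i, w i = 1) :
    IsOptimalUnconstrained x w fun _ => c := by
  intro y _
  have h := cone_sum_mul_le_integral_exp hfull hc hw y
  change ∑ i, w i * y i - _ ≤ ∑ i, w i * c - _
  rw [integral_exp_tent_const hc, ← Finset.sum_mul, hw1]
  rw [hw1] at h
  linarith

theorem eq_const_of_objective_ge {x : Fin n → EuclideanSpace ℝ (Fin d)}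
    (hfull : affineSpan ℝ (range x) = ⊤) {c : ℝ}
    (hc : Real.exp c * volume.real (polytope x) = 1) {w : Fin n → ℝ}
    (hw : w ∈ coneOverSecondaryPolytope x) (hw1 : ∑ i, w i = 1) {y : Fin n → ℝ}
    (h : ∑ i, w i * c - ∫ t in polytope x, Real.exp (tent x (fun _ => c) t) ≤
      ∑ i, w i * y i - ∫ t in polytope x, Real.exp (tent x y t))
    (hy : (∀ i, 0 < w i) ∨ IsRelevant x y) : y = fun _ => c := by
  refine eq_const_of_sum_mul_eq hfull hc hw (fun h0 => by simp [h0] at hw1) ?_ hy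
  rw [integral_exp_tent_const hc, ← Finset.sum_mul, hw1] at h
  rw [hw1]
  linarith

theorem const_mem_secondaryCone (x : Fin n → EuclideanSpace ℝ (Fin d))
    (Δ : Finset (Finset (Fin n))) (c : ℝ) : (fun _ => c) ∈ secondaryCone x Δ :=
  fun _ _ => ⟨AffineMap.const ℝ _ c, fun _ _ => rfl, fun _ => le_rfl⟩

theorem IsRegularTriangulation.secondaryObjective_eq {x : Fin n → EuclideanSpace ℝ (Fin d)}
    {Δ : Finset (Finset (Fin n))} (h : IsRegularTriangulation x Δ) (w : Fin n → ℝ)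
    {y : Fin n → ℝ} (hy : y ∈ secondaryCone x Δ) :
    secondaryObjective x w Δ y =
      ∑ i, w i * y i - ∫ t in polytope x, Real.exp (tent x y t) := by
  rw [secondaryObjective, h.integral_exp_tent hy]

theorem isOptimalSecondary_const {x : Fin n → EuclideanSpace ℝ (Fin d)}
    (hfull : affineSpan ℝ (range x) = ⊤) {c : ℝ}
    (hc : Real.exp c * volume.real (polytope x) = 1) {w : Fin n → ℝ}
    (hw : w ∈ coneOverSecondaryPolytope x) (hw1 : ∑ i, w i = 1) {Δ : Finset (Finset (Fin n))}
    (hΔ : IsRegularTriangulation x Δ) : IsOptimalSecondary x w Δ fun _ => c := by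
  refine ⟨⟨hΔ, const_mem_secondaryCone x Δ c⟩, ?_⟩
  rintro ⟨Δ', y⟩ ⟨hΔ', hy⟩
  change secondaryObjective x w Δ' y ≤ secondaryObjective x w Δ fun _ => c
  rw [hΔ'.secondaryObjective_eq w hy, hΔ.secondaryObjective_eq w (const_mem_secondaryCone x Δ c)]
  exact isOptimalUnconstrained_const hfull hc hw hw1 (mem_univ y)

theorem eq_const_of_isOptimalSecondary {x : Fin n → EuclideanSpace ℝ (Fin d)}
    (hfull : affineSpan ℝ (range x) = ⊤) {c : ℝ}
    (hc : Real.exp c * volume.real (polytope x) = 1) {w : Fin n → ℝ}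
    (hw : w ∈ coneOverSecondaryPolytope x) (hw1 : ∑ i, w i = 1) {Δ : Finset (Finset (Fin n))}
    {y : Fin n → ℝ} (h : IsOptimalSecondary x w Δ y)
    (hy : (∀ i, 0 < w i) ∨ IsRelevant x y) : y = fun _ => c := by
  obtain ⟨⟨hΔ, hyΔ⟩, hmax⟩ := h
  have hcΔ := const_mem_secondaryCone x Δ c
  have h1 : secondaryObjective x w Δ (fun _ => c) ≤ secondaryObjective x w Δ y :=
    hmax (show (Δ, fun _ => c) ∈ {p : Finset (Finset (Fin n)) × (Fin n → ℝ) |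
      IsRegularTriangulation x p.1 ∧ p.2 ∈ secondaryCone x p.1} from ⟨hΔ, hcΔ⟩)
  rw [hΔ.secondaryObjective_eq w hyΔ, hΔ.secondaryObjective_eq w hcΔ] at h1
  exact eq_const_of_objective_ge hfull hc hw hw1 h1 hy

/-! ### Log-concave densities -/

theorem tentDensity_const (x : Fin n → EuclideanSpace ℝ (Fin d)) (c : ℝ) :
    tentDensity x (fun _ => c) = (polytope x).indicator fun _ => Real.exp c := by
  ext t
  by_cases ht : t ∈ polytope x
  · rw [tentDensity, indicator_of_mem ht, indicator_of_mem ht, tent_const x c ht]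
  · rw [tentDensity, indicator_of_notMem ht, indicator_of_notMem ht]

theorem integral_tentDensity_const {x : Fin n → EuclideanSpace ℝ (Fin d)} {c : ℝ}
    (hc : Real.exp c * volume.real (polytope x) = 1) :
    ∫ t, tentDensity x (fun _ => c) t = 1 := by
  rw [tentDensity, integral_indicator (polytope_isCompact x).measurableSet,
    integral_exp_tent_const hc]

theorem tentDensity_const_mem {x : Fin n → EuclideanSpace ℝ (Fin d)} {c : ℝ}
    (hc : Real.exp c * volume.real (polytope x) = 1) :
    tentDensity x (fun _ => c) ∈ logConcaveDensities d := by
  refine ⟨fun t => ?_, ?_, ?_, integral_tentDensity_const hc⟩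
  · exact indicator_nonneg (fun _ _ => (Real.exp_pos _).le) t
  · exact (integrable_indicator_iff (polytope_isCompact x).measurableSet).2
      (comp_tent_integrableOn x _ Real.continuous_exp)
  · have hP : {t | 0 < tentDensity x (fun _ => c) t} = polytope x := by
      ext t
      by_cases ht : t ∈ polytope x <;> simp [tentDensity_const, ht, Real.exp_pos]
    rw [hP]
    refine (concaveOn_const c (polytope_convex x)).congr fun t ht => ?_
    simp [tentDensity_const, ht]

theorem coe_sum_ereal {ι : Type*} (s : Finset ι) (f : ι → ℝ) :
    ((∑ i ∈ s, f i : ℝ) : EReal) = ∑ i ∈ s, (f i : EReal) := by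
  classical
  induction s using Finset.induction_on with
  | empty => simp
  | insert i s hi ih => rw [Finset.sum_insert hi, Finset.sum_insert hi, EReal.coe_add, ih]

theorem logLikelihood_of_pos {x : Fin n → EuclideanSpace ℝ (Fin d)} (w : Fin n → ℝ)
    {f : EuclideanSpace ℝ (Fin d) → ℝ} (hf : ∀ i, 0 < f (x i)) :
    logLikelihood x w f = ((∑ i, w i * Real.log (f (x i)) : ℝ) : EReal) := by
  rw [logLikelihood, coe_sum_ereal]
  refine Finset.sum_congr rfl fun i _ => ?_
  rw [ENNReal.log_ofReal_of_pos (hf i), EReal.coe_mul]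

/-- In `EReal` the value `⊥` absorbs every summand, so the other terms do not matter. -/
theorem logLikelihood_eq_bot {x : Fin n → EuclideanSpace ℝ (Fin d)} {w : Fin n → ℝ}
    {f : EuclideanSpace ℝ (Fin d) → ℝ} {i : Fin n} (hw : 0 < w i) (hf : f (x i) ≤ 0) :
    logLikelihood x w f = ⊥ := by
  classical
  rw [logLikelihood, ← Finset.add_sum_erase _ _ (Finset.mem_univ i), ENNReal.ofReal_of_nonpos hf,
    ENNReal.log_zero, EReal.coe_mul_bot_of_pos hw, EReal.bot_add]

theorem logLikelihood_const (x : Fin n → EuclideanSpace ℝ (Fin d)) (w : Fin n → ℝ) (c : ℝ) :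
    logLikelihood x w (tentDensity x fun _ => c) = ((∑ i, w i * c : ℝ) : EReal) := by
  have h : ∀ i, tentDensity x (fun _ => c) (x i) = Real.exp c := fun i => by
    rw [tentDensity_const, indicator_of_mem (vertex_mem_polytope x i)]
  rw [logLikelihood_of_pos w fun i => (h i).symm ▸ Real.exp_pos c]
  simp only [h, Real.log_exp]

/-- The set where `f > 0` is convex, so positivity at the points of positive weight spreads to their
hull. -/
theorem polytope_subset_support {x : Fin n → EuclideanSpace ℝ (Fin d)}
    (hfull : affineSpan ℝ (range x) = ⊤) {w : Fin n → ℝ}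
    (hw : w ∈ coneOverSecondaryPolytope x) (hw0 : w ≠ 0)
    {f : EuclideanSpace ℝ (Fin d) → ℝ} (hf : f ∈ logConcaveDensities d)
    (hpos : ∀ i, 0 < w i → 0 < f (x i)) : polytope x ⊆ {t | 0 < f t} := by
  refine (cone_polytope_subset hfull hw hw0).trans (convexHull_min ?_ hf.2.2.1.1)
  rintro _ ⟨i, hi, rfl⟩
  exact hpos i hi

theorem tent_log_le {x : Fin n → EuclideanSpace ℝ (Fin d)}
    {f : EuclideanSpace ℝ (Fin d) → ℝ} (hf : f ∈ logConcaveDensities d)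
    (hpos : polytope x ⊆ {t | 0 < f t}) {t : EuclideanSpace ℝ (Fin d)} (ht : t ∈ polytope x) :
    tent x (fun i => Real.log (f (x i))) t ≤ Real.log (f t) :=
  tent_le_of_concaveOn x _ (hf.2.2.1.subset hpos (polytope_convex x)) (fun _ => le_rfl) ht

theorem log_mem_samworthBody {x : Fin n → EuclideanSpace ℝ (Fin d)}
    {f : EuclideanSpace ℝ (Fin d) → ℝ} (hf : f ∈ logConcaveDensities d)
    (hpos : polytope x ⊆ {t | 0 < f t}) :
    (fun i => Real.log (f (x i))) ∈ samworthBody x := by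
  obtain ⟨h0, hint, -, h1⟩ := id hf
  calc ∫ t in polytope x, Real.exp (tent x (fun i => Real.log (f (x i))) t)
      ≤ ∫ t in polytope x, f t := by
        refine setIntegral_mono_on (comp_tent_integrableOn x _ Real.continuous_exp)
          hint.integrableOn (polytope_isCompact x).measurableSet fun t ht => ?_
        rw [← Real.le_log_iff_exp_le (hpos ht)]
        exact tent_log_le hf hpos ht
    _ ≤ ∫ t, f t := setIntegral_le_integral hint (.of_forall h0)
    _ = 1 := h1

theorem isOptimalDensity_const {x : Fin n → EuclideanSpace ℝ (Fin d)}
    (hfull : affineSpan ℝ (range x) = ⊤) {c : ℝ}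
    (hc : Real.exp c * volume.real (polytope x) = 1) {w : Fin n → ℝ}
    (hw : w ∈ coneOverSecondaryPolytope x) :
    IsOptimalDensity x w (tentDensity x fun _ => c) := by
  refine ⟨tentDensity_const_mem hc, fun f hf => ?_⟩
  change logLikelihood x w f ≤ _
  by_cases hw0 : w = 0
  · simp [hw0, logLikelihood]
  by_cases hpos : ∀ i, 0 < w i → 0 < f (x i)
  · have hP := polytope_subset_support hfull hw hw0 hf hpos
    rw [logLikelihood_of_pos w fun i => hP (vertex_mem_polytope x i), logLikelihood_const,
      EReal.coe_le_coe_iff]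
    exact (isOptimalConstrained_const hfull hc hw).2 (log_mem_samworthBody hf hP)
  · push Not at hpos
    obtain ⟨i, hi, hfi⟩ := hpos
    rw [logLikelihood_eq_bot hi hfi]
    exact bot_le

/-- A log-concave function which agrees almost everywhere with the uniform density on a convex
body, and dominates it everywhere, agrees with it everywhere. -/
theorem eq_indicator_of_ae_eq {P : Set (EuclideanSpace ℝ (Fin d))} (hP : IsCompact P)
    (hPi : (interior P).Nonempty) (hPc : Convex ℝ P) {c : ℝ}
    {f : EuclideanSpace ℝ (Fin d) → ℝ}
    (hf : ConcaveOn ℝ {t | 0 < f t} fun t => Real.log (f t))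
    (hge : ∀ t, P.indicator (fun _ => Real.exp c) t ≤ f t)
    (hae : f =ᵐ[volume] P.indicator fun _ => Real.exp c) :
    f = P.indicator fun _ => Real.exp c := by
  have hfP : ∀ p ∈ P, Real.exp c ≤ f p := fun p hp => by
    simpa [indicator_of_mem hp] using hge p
  have hpos : ∀ p ∈ P, 0 < f p := fun p hp => (Real.exp_pos c).trans_le (hfP p hp)
  -- A copy of `P` shrunk towards `t` has positive volume, so `f` cannot strictly exceed the uniform
  -- density on all of it.
  have hneg : ∀ t, ∀ s ∈ Ioo (0 : ℝ) 1,
      ¬ ∀ p ∈ P, P.indicator (fun _ => Real.exp c) ((1 - s) • t + s • p) < f ((1 - s) • t + s • p) := by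
    intro t s hs hlt
    have hsub : AffineMap.homothety t s '' P ⊆ {q | f q ≠ P.indicator (fun _ => Real.exp c) q} := by
      rintro _ ⟨p, hp, rfl⟩
      have hq : AffineMap.homothety t s p = (1 - s) • t + s • p := by
        simp only [AffineMap.homothety_apply, vsub_eq_sub, vadd_eq_add, smul_sub, sub_smul, one_smul]
        abel
      rw [hq]
      exact (hlt p hp).ne'
    have hz := measure_mono_null hsub (ae_iff.1 hae)
    rw [Measure.addHaar_image_homothety] at hz
    rcases mul_eq_zero.1 hz with h | h
    · have : 0 < |s ^ Module.finrank ℝ (EuclideanSpace ℝ (Fin d))| :=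
        abs_pos.2 (pow_ne_zero _ hs.1.ne')
      exact (ENNReal.ofReal_pos.2 this).ne' h
    · exact (Measure.measure_pos_of_nonempty_interior volume hPi).ne' h
  ext t
  by_contra hne
  have hlt := (hge t).lt_of_ne' hne
  by_cases ht : t ∈ P
  · rw [indicator_of_mem ht] at hlt
    -- For `t ∈ P`, concavity of `log f` passes a strict excess at `t` on to every midpoint with a
    -- point of `P`.
    refine hneg t (1 / 2) (by norm_num) fun p hp => ?_
    have hm : (1 - 1 / 2 : ℝ) • t + (1 / 2 : ℝ) • p ∈ P :=
      hPc ht hp (by norm_num) (by norm_num) (by norm_num)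
    rw [indicator_of_mem hm]
    have h := hf.2 (hpos t ht) (hpos p hp) (by norm_num : (0 : ℝ) ≤ 1 - 1 / 2)
      (by norm_num : (0 : ℝ) ≤ 1 / 2) (by norm_num)
    have h1 := (Real.lt_log_iff_exp_lt (hpos t ht)).2 hlt
    have h2 := (Real.le_log_iff_exp_le (hpos p hp)).2 (hfP p hp)
    rw [← Real.lt_log_iff_exp_lt (hpos _ hm)]
    simp only [smul_eq_mul] at h
    linarith
  · rw [indicator_of_notMem ht] at hlt
    obtain ⟨ε, hε, hball⟩ := Metric.isOpen_iff.1 hP.isClosed.isOpen_compl t ht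
    obtain ⟨R, hR, hPR⟩ := hP.isBounded.subset_ball_lt 0 t
    -- For `t ∉ P` this factor moves the ball of radius `R` around `t`, which contains `P`, into the
    -- ball of radius `ε`, which misses `P`; there `f` is positive by convexity of its support.
    refine hneg t (ε / (R + ε)) ⟨by positivity, (div_lt_one (by positivity)).2 (by linarith)⟩
      fun p hp => ?_
    have hs0 : 0 ≤ ε / (R + ε) := by positivity
    have hs1 : ε / (R + ε) ≤ 1 := (div_le_one (by positivity)).2 (by linarith)
    have hm : (1 - ε / (R + ε)) • t + (ε / (R + ε)) • p ∉ P := by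
      apply hball
      have hpR : ‖p - t‖ < R := by simpa [dist_eq_norm] using hPR hp
      have heq : (1 - ε / (R + ε)) • t + (ε / (R + ε)) • p - t = (ε / (R + ε)) • (p - t) := by
        rw [sub_smul, one_smul, smul_sub]; abel
      rw [Metric.mem_ball, dist_eq_norm, heq, norm_smul, Real.norm_of_nonneg hs0,
        div_mul_eq_mul_div, div_lt_iff₀ (by positivity)]
      nlinarith
    rw [indicator_of_notMem hm]
    exact hf.1 hlt (hpos p hp) (by linarith) hs0 (by ring)

/-- The log values of an optimal `f` solve the Samworth problem, so they are all `c`. Then `f`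
dominates the uniform density and has the same integral, which gives equality almost everywhere;
log-concavity removes the exceptional set. -/
theorem eq_tentDensity_of_isOptimalDensity {x : Fin n → EuclideanSpace ℝ (Fin d)}
    (hfull : affineSpan ℝ (range x) = ⊤) {c : ℝ}
    (hc : Real.exp c * volume.real (polytope x) = 1) {w : Fin n → ℝ}
    (hw : w ∈ coneOverSecondaryPolytope x) (hw0 : w ≠ 0)
    {f : EuclideanSpace ℝ (Fin d) → ℝ} (h : IsOptimalDensity x w f) :
    f = tentDensity x fun _ => c := by
  obtain ⟨hf, hmax⟩ := h
  have hmax : logLikelihood x w (tentDensity x fun _ => c) ≤ logLikelihood x w f :=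
    hmax (tentDensity_const_mem hc)
  have hpos : ∀ i, 0 < w i → 0 < f (x i) := fun i hi => by
    by_contra hfi
    rw [logLikelihood_eq_bot hi (not_lt.1 hfi), logLikelihood_const, le_bot_iff] at hmax
    exact EReal.coe_ne_bot _ hmax
  have hP := polytope_subset_support hfull hw hw0 hf hpos
  have hvpos : ∀ i, 0 < f (x i) := fun i => hP (vertex_mem_polytope x i)
  rw [logLikelihood_of_pos w hvpos, logLikelihood_const, EReal.coe_le_coe_iff] at hmax
  have hopt : IsOptimalConstrained x w fun i => Real.log (f (x i)) :=
    ⟨log_mem_samworthBody hf hP, fun y hy =>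
      ((isOptimalConstrained_const hfull hc hw).2 hy).trans hmax⟩
  -- The log values are relevant because `log f` is itself a concave majorant of them.
  have hy := eq_const_of_isOptimalConstrained hfull hc hw hw0 hopt (Or.inr fun i =>
    le_antisymm (tent_log_le hf hP (vertex_mem_polytope x i)) (le_tent_vertex x (fun i => Real.log (f (x i))) i))
  have hge : ∀ t, (polytope x).indicator (fun _ => Real.exp c) t ≤ f t := fun t => by
    by_cases ht : t ∈ polytope x
    · rw [indicator_of_mem ht, ← Real.le_log_iff_exp_le (hP ht), ← tent_const x c ht, ← hy]
      exact tent_log_le hf hP ht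
    · rw [indicator_of_notMem ht]
      exact hf.1 t
  obtain ⟨-, hDi, -, hD1⟩ := tentDensity_const_mem (x := x) hc
  rw [tentDensity_const] at hDi hD1 ⊢
  refine eq_indicator_of_ae_eq (polytope_isCompact x) (polytope_interior_nonempty hfull)
    (polytope_convex x) hf.2.2.1 hge ?_
  exact ((integral_eq_iff_of_ae_le hDi hf.2.1 (.of_forall hge)).1
    (hD1.trans hf.2.2.2.symm)).symm

end LogConcaveMLE

end

theorem corollary3p8 {d n : ℕ} (x : Fin n → EuclideanSpace ℝ (Fin d))
    (hx : Function.Injective x) (hfull : affineSpan ℝ (Set.range x) = ⊤)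
    (c : ℝ) (hc : c = -Real.log (MeasureTheory.volume.real (LogConcaveMLE.polytope x)))
    (ystar : Fin n → ℝ) (hy : ystar = fun _ => c) :
    -- the normalization `∫ f_{X,y*} = 1`
    (∫ t, LogConcaveMLE.tentDensity x ystar t = 1) ∧
    -- the weight vectors are multiples of the GKZ vectors
    (∀ Δ, LogConcaveMLE.IsRegularTriangulation x Δ →
      LogConcaveMLE.weightVector x Δ ystar =
        (Real.exp c / ((d + 1).factorial : ℝ)) • LogConcaveMLE.gkz x Δ) ∧
    -- optimality for every weight vector in the cone over the secondary polytope
    (∀ w ∈ LogConcaveMLE.coneOverSecondaryPolytope x,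
      -- maximum likelihood over log-concave densities
      LogConcaveMLE.IsOptimalDensity x w (LogConcaveMLE.tentDensity x ystar) ∧
      (w ≠ 0 → ∀ f, LogConcaveMLE.IsOptimalDensity x w f →
        f = LogConcaveMLE.tentDensity x ystar) ∧
      -- linear optimization over the Samworth body
      LogConcaveMLE.IsOptimalConstrained x w ystar ∧
      (w ≠ 0 → ∀ y, LogConcaveMLE.IsOptimalConstrained x w y →
        ((∀ i, 0 < w i) ∨ LogConcaveMLE.IsRelevant x y) → y = ystar) ∧
      -- the unconstrained problem and its exponential-rational form
      (∑ i, w i = 1 →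
        LogConcaveMLE.IsOptimalUnconstrained x w ystar ∧
        (∀ y, LogConcaveMLE.IsOptimalUnconstrained x w y →
          ((∀ i, 0 < w i) ∨ LogConcaveMLE.IsRelevant x y) → y = ystar) ∧
        (∀ Δ, LogConcaveMLE.IsRegularTriangulation x Δ →
          LogConcaveMLE.IsOptimalSecondary x w Δ ystar) ∧
        (∀ Δ y, LogConcaveMLE.IsOptimalSecondary x w Δ y →
          ((∀ i, 0 < w i) ∨ LogConcaveMLE.IsRelevant x y) → y = ystar))) := by
  have hV := LogConcaveMLE.volume_polytope_pos hfull
  have hcV : Real.exp c * MeasureTheory.volume.real (LogConcaveMLE.polytope x) = 1 := by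
    rw [hc, Real.exp_neg, Real.exp_log hV, inv_mul_cancel₀ hV.ne']
  subst hy
  open LogConcaveMLE in
  exact ⟨integral_tentDensity_const hcV, fun Δ hΔ => hΔ.weightVector_const c, fun w hw =>
    ⟨isOptimalDensity_const hfull hcV hw,
      fun hw0 f hf => eq_tentDensity_of_isOptimalDensity hfull hcV hw hw0 hf,
      isOptimalConstrained_const hfull hcV hw,
      fun hw0 y h hy => eq_const_of_isOptimalConstrained hfull hcV hw hw0 h hy,
      fun hw1 => ⟨isOptimalUnconstrained_const hfull hcV hw hw1,
        fun y h hy => eq_const_of_objective_ge hfull hcV hw hw1 (h (mem_univ _)) hy,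
        fun Δ hΔ => isOptimalSecondary_const hfull hcV hw hw1 hΔ,
        fun Δ y h hy => eq_const_of_isOptimalSecondary hfull hcV hw hw1 h hy⟩⟩⟩
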